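/- **Setting.** A degree distribution pair with $m$ edge-types consists of polynomials $\nu(\mathbf r,\mathbf x)=\sum_{\mathbf b,\mathbf d}\nu_{\mathbf b,\mathbf d}\mathbf r^{\mathbf b}\mathbf x^{\mathbf d}$ and $\mu(\mathbf x)=\sum_{\mathbf d}\mu_{\mathbf d}\mathbf x^{\mathbf d}$ with non-negative real coefficients, where $\mathbf b=(b_0,b_1)\in\{(1,0),(0,1)\}$ (punctured / transmitted) and $\mathbf d\in\mathbb Z_{\ge0}^m$, such that $\sum_{\mathbf d}\nu_{(0,1),\mathbf d}=1$ and $\sum_{\mathbf b,\mathbf d}d_i\nu_{\mathbf b,\mathbf d}=\sum_{\mathbf d}d_i\mu_{\mathbf d}=:\mu_i(\mathbf 1)>0$ for every $i$. For $n\ge1$ such that all $n\nu_{\mathbf b,\mathbf d}$ and $n\mu_{\mathbf d}$ are integers, the ensemble of length $n$ has $n\nu_{\mathbf b,\mathbf d}$ variable nodes of channel-type $\mathbf b$ and node-type $\mathbf d$ (each with $d_i$ sockets of edge-type $i$) and $n\mu_{\mathbf d}$ check nodes of node-type $\mathbf d$; for each $i$, the variable sockets of edge-type $i$ are matched to the check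 sockets of edge-type $i$ by a bijection, and all choices of bijections are equiprobable. A $0/1$-labelling of the variable nodes is a codeword if at every check node the sum of the labels over the incident edges (with multiplicity) is even; its weight is the number of transmitted variable nodes labelled $1$. Let $A(\ell)$ be the average over the ensemble of the number of codewords of weight $\ell$. Put $$Q(t,\mathbf s)=\prod_{\mathbf b,\mathbf d}(1+t^{b_1}\mathbf s^{\mathbf d})^{\nu_{\mathbf b,\mathbf d}},\qquad P(\mathbf u)=\prod_{\mathbf d}\Bigl(\tfrac{(\mathbf 1+\mathbf u)^{\mathbf d}+(\mathbf 1-\mathbf u)^{\mathbf d}}2\Bigr)^{\mu_{\mathbf d}},$$ and let $h(x)=-x\log x-(1-x)\log(1-x)$. For $\omega\in\mathbb R$ and $\boldsymbol\beta\in\mathbb R_{\ge0}^m$ let $$\gamma(\boldsymbol\beta)=\inf_{t>0,\,\mathbf s>\mathbf 0,\,\mathbf u>\mathbf 0}\Bigl[\log Q(t,\mathbf s)+\log P(\mathbf u) -\sum_i\beta_i\log u_i-\sum_i\beta_i\log s_i-\omega\log t-\sum_i\mu_i(\mathbf 1)\,h\Bigl(\frac{\beta_i}{\mu_i(\mathbf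 1)}\Bigr)\Bigr]\in[-\infty,\infty)$$ (the value is $-\infty$ if $\beta_i>\mu_i(\mathbf 1)$ for some $i$). Let $\mathfrak B(\omega)$ be the set of all $\boldsymbol\beta$ for which there are $t>0$, $\mathbf s>\mathbf 0$, $\mathbf u>\mathbf 0$ with $$\omega=\frac{t\,\partial_tQ}{Q},\qquad \beta_i=\frac{u_i\,\partial_{u_i}P}{P},\qquad \beta_i=\frac{s_i\,\partial_{s_i}Q}{Q},\qquad \frac{\beta_i}{\mu_i(\mathbf 1)-\beta_i}=u_is_i\qquad(i=1,\dots,m).$$ **Theorem.** For every degree distribution pair and every $\omega\in\mathbb R$, the growth rate $\gamma(\omega)=\lim_{n\to\infty}\frac1n\log A(\omega n)$ is $$\gamma(\omega)=\sup_{\boldsymbol\beta\ge\mathbf 0}\gamma(\boldsymbol\beta),$$ where $n$ tends to infinity through the lengths for which the ensemble exists, $\omega n$ is a non-negative integer and $A(\omega n)\ne0$. If moreover the extrema in this $\sup_{\boldsymbol\beta}\inf_{t,\mathbf s,\mathbf u}$ are attained, i.e. some $\boldsymbol\beta\ge\mathbf 0$ attains the supremum and some $t>0$, $\mathbf s>\mathbf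 0$, $\mathbf u>\mathbf 0$ attain the infimum $\gamma(\boldsymbol\beta)$, then $$\sup_{\boldsymbol\beta\ge\mathbf 0}\gamma(\boldsymbol\beta)=\max_{\boldsymbol\beta\in\mathfrak B(\omega)}\gamma(\boldsymbol\beta),$$ the maximum being attained; so $\gamma(\omega)=\max_{\boldsymbol\beta\in\mathfrak B(\omega)}\gamma(\boldsymbol\beta)$ whenever the limit is over infinitely many $n$. -/

import Mathlib

open scoped BigOperators Topology
open Filter

namespace MET

/-- A degree distribution pair `(ν(r, x), μ(x))` with `m` edge-types and one channel-type.
`nu (b, d)` is the coefficient of `r^(1 - b, b) x^d` in `ν`: the value `b = 0` stands for punctured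
nodes (channel vector `(1, 0)`), the value `b = 1` for transmitted nodes (channel vector `(0, 1)`).
`mu d` is the coefficient of `x^d` in `μ`. -/
structure DegreePair (m : ℕ) where
  nu : (Fin 2 × (Fin m → ℕ)) →₀ ℝ
  mu : (Fin m → ℕ) →₀ ℝ
  nu_nonneg : ∀ τ, 0 ≤ nu τ
  mu_nonneg : ∀ d, 0 ≤ mu d
  /-- a code of length `n` has `n` transmitted variable nodes -/
  transmitted : (∑ τ ∈ nu.support, if τ.1 = 1 then nu τ else 0) = 1
  /-- the two sides of the graph have the same number of edges of each edge-type -/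
  edges_eq : ∀ i, ∑ τ ∈ nu.support, (τ.2 i : ℝ) * nu τ = ∑ d ∈ mu.support, (d i : ℝ) * mu d
  /-- every edge-type occurs -/
  edges_pos : ∀ i, 0 < ∑ d ∈ mu.support, (d i : ℝ) * mu d

namespace DegreePair

variable {m : ℕ} (D : DegreePair m)

/-- `μ_i(1)`, the number of edges of edge-type `i` divided by the code length. -/
noncomputable def muDeriv (i : Fin m) : ℝ := ∑ d ∈ D.mu.support, (d i : ℝ) * D.mu d

/-- The lengths for which the numbers of nodes of all types are integers. -/
def Admissible (n : ℕ) : Prop :=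
  0 < n ∧ (∀ τ, ∃ k : ℕ, (n : ℝ) * D.nu τ = k) ∧ (∀ d, ∃ k : ℕ, (n : ℝ) * D.mu d = k)

/-- Variable nodes: `n ν_{b,d}` of them for each channel-type `b` and node-type `d`
(for admissible `n` the floor is exact). -/
abbrev VarNode (n : ℕ) : Type :=
  Σ τ : {τ // τ ∈ D.nu.support}, Fin ⌊(n : ℝ) * D.nu τ.1⌋₊

/-- Check nodes: `n μ_d` of them for each node-type `d`. -/
abbrev CheckNode (n : ℕ) : Type :=
  Σ d : {d // d ∈ D.mu.support}, Fin ⌊(n : ℝ) * D.mu d.1⌋₊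

/-- The ends of edges of edge-type `i` at the variable nodes. -/
abbrev VarSocket (n : ℕ) (i : Fin m) : Type := Σ v : D.VarNode n, Fin (v.1.1.2 i)

/-- The ends of edges of edge-type `i` at the check nodes. -/
abbrev CheckSocket (n : ℕ) (i : Fin m) : Type := Σ c : D.CheckNode n, Fin (c.1.1 i)

/-- The graphs of the ensemble: for every edge-type, the `E_i` variable node sockets are connected
to the `E_i` check node sockets by an arbitrary bijection. -/
abbrev Graph (n : ℕ) : Type := ∀ i : Fin m, D.VarSocket n i ≃ D.CheckSocket n i

noncomputable instance instFintypeGraph (n : ℕ) : Fintype (D.Graph n) := by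
  haveI : ∀ i, Finite (D.VarSocket n i) := fun i => inferInstance
  haveI : ∀ i, Finite (D.CheckSocket n i) := fun i => inferInstance
  exact Fintype.ofFinite _

variable {D}

/-- `x` is a codeword of `G`: the sum over the edges at each check node is even. -/
def IsCodeword {n : ℕ} (G : D.Graph n) (x : D.VarNode n → ZMod 2) : Prop :=
  ∀ c : D.CheckNode n,
    ∑ i : Fin m, ∑ j : Fin (c.1.1 i), x ((G i).symm ⟨c, j⟩).1 = 0

/-- The number of transmitted variable nodes `v` with `x v = 1`. -/
noncomputable def weight {n : ℕ} (x : D.VarNode n → ZMod 2) : ℕ :=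
  (Finset.univ.filter fun v : D.VarNode n => v.1.1.1 = 1 ∧ x v = 1).card

/-- The number `A_G(ℓ)` of codewords of weight `ℓ` of `G`. -/
noncomputable def numCodewords {n : ℕ} (G : D.Graph n) (ℓ : ℕ) : ℕ :=
  Nat.card {x : D.VarNode n → ZMod 2 // IsCodeword G x ∧ weight x = ℓ}

variable (D)

/-- The average number `A(ℓ)` of codewords of weight `ℓ` over the ensemble of length `n`. -/
noncomputable def avgCodewords (n ℓ : ℕ) : ℝ :=
  (∑ G : D.Graph n, (numCodewords G ℓ : ℝ)) / (Fintype.card (D.Graph n) : ℝ)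

/-- `Q(t, s)` -/
noncomputable def Q (t : ℝ) (s : Fin m → ℝ) : ℝ :=
  ∏ τ ∈ D.nu.support, (1 + t ^ (τ.1 : ℕ) * ∏ i, s i ^ τ.2 i) ^ D.nu τ

/-- `P(u)` -/
noncomputable def P (u : Fin m → ℝ) : ℝ :=
  ∏ d ∈ D.mu.support, (((∏ i, (1 + u i) ^ d i) + ∏ i, (1 - u i) ^ d i) / 2) ^ D.mu d

/-- The expression whose infimum over `t, s, u > 0` is `γ(β)`. -/
noncomputable def objective (ω : ℝ) (β : Fin m → ℝ) (t : ℝ) (s u : Fin m → ℝ) : ℝ :=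
  Real.log (D.Q t s) + Real.log (D.P u)
    - ∑ i, β i * Real.log (u i) - ∑ i, β i * Real.log (s i) - ω * Real.log t
    - ∑ i, D.muDeriv i * Real.binEntropy (β i / D.muDeriv i)

/-- `γ(β)`, an extended real number since the infimum may be `-∞`. -/
noncomputable def gammaBeta (ω : ℝ) (β : Fin m → ℝ) : EReal :=
  ⨅ (t : ℝ) (s : Fin m → ℝ) (u : Fin m → ℝ) (_ : 0 < t ∧ (∀ i, 0 < s i) ∧ ∀ i, 0 < u i),
    (D.objective ω β t s u : EReal)

/-- `sup_{β ≥ 0} γ(β)` -/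
noncomputable def supGamma (ω : ℝ) : EReal :=
  ⨆ (β : Fin m → ℝ) (_ : ∀ i, 0 ≤ β i), D.gammaBeta ω β

/-- The set `𝔅(ω)` of all `β` for which the saddle-point equations and the stationarity condition
hold with some `t, s, u > 0`. -/
def stationarySet (ω : ℝ) : Set (Fin m → ℝ) :=
  {β | ∃ (t : ℝ) (s u : Fin m → ℝ), 0 < t ∧ (∀ i, 0 < s i) ∧ (∀ i, 0 < u i) ∧
    ω = t * deriv (fun y => D.Q y s) t / D.Q t s ∧
    (∀ i, β i = u i * deriv (fun y => D.P (Function.update u i y)) (u i) / D.P u) ∧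
    (∀ i, β i = s i * deriv (fun y => D.Q t (Function.update s i y)) (s i) / D.Q t s) ∧
    (∀ i, β i / (D.muDeriv i - β i) = u i * s i)}

/-- The extrema in `sup_β inf_{t,s,u}` are attained: some `β ≥ 0` attains the supremum, and some
point `t, s, u > 0` attains the infimum `γ(β)` at it. -/
def ExtremaAttained (ω : ℝ) : Prop :=
  ∃ (β : Fin m → ℝ) (t : ℝ) (s u : Fin m → ℝ),
    (∀ i, 0 ≤ β i) ∧ 0 < t ∧ (∀ i, 0 < s i) ∧ (∀ i, 0 < u i) ∧
    D.supGamma ω = D.gammaBeta ω β ∧ D.gammaBeta ω β = (D.objective ω β t s u : EReal)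

/-- `n → ∞` through the lengths for which the ensemble of length `n` exists, `ω n` is an integer
and `A(ω n) ≠ 0`, that is, through all lengths for which `log A(ω n)` is meaningful. -/
def lengths (ω : ℝ) : Filter ℕ :=
  atTop ⊓ 𝓟 {n : ℕ | D.Admissible n ∧ (∃ ℓ : ℕ, ω * n = ℓ) ∧ D.avgCodewords n ⌊ω * n⌋₊ ≠ 0}

end DegreePair

end MET

/-!
Write `n · ρ_j` for the number of nodes of type `j` (variable or check). A variable node is in state
`0` or `1`, the state of a check node is a labelling of its sockets with even sum, and a codeword of
a graph is an assignment of states to all nodes whose labels agree along the edges. Averaging over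
the matchings of the sockets, an assignment with `e_i` sockets of type `i` labelled `1` on each side
counts with the weight `∏ i, 1 / (E_i choose e_i)`, which gives `Admissible.avgCodewords_eq`:
`A(ℓ) = ∑_e coeff(ℓ, e) ∏ i, 1 / (E_i choose e_i)`, a sum of polynomially many terms.

*Upper bound.* A coefficient of `Q^n P^n` is at most the value of the generating function divided by
the monomial, and binomials are exponentials of entropies up to polynomial factors. Hence the rate
of each term is at most `γ(e / n) + o(1)` (`Admissible.rate_sub_error_le`).

*Lower bound.* The number of assignments with a given profile (the numbers of nodes of each type in
each state) is a product of multinomials, hence has the profile entropy as its rate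
(`Admissible.profile_le_rate`). Two facts link integer profiles to `γ(β)`. Strong duality
(`exists_profile_entropy_ge`): unless it is `-∞`, `γ(β)` is the largest entropy of a real profile
with the moments prescribed by `ω` and `β`, minus the entropy of the matchings. It is proved without
attainment in `t, s, u`, by adding a small quadratic penalty to the dual problem and using the
compactness of the set of profiles.
Rounding (`exists_nat_point_near`): the constraints on the profiles form a linear system with
integer coefficients; since `A(ω n) ≠ 0` provides one integer profile, adding integer vectors of the
kernel, which span it over `ℝ`, provides one near each real profile.

*Stationary points.* If the extrema are attained at `β` and `y = log (t, s, u)`, then the first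
three stationarity equations are Fermat's theorem. The Gibbs profile at `y` maximises, over all `β`
at once, the profile entropy minus the entropy of the matchings, and it is positive, so the first
variation vanishes in all admissible directions (`first_variation_eq_zero`). As `γ` may be `-∞` off a proper affine subspace, this does not
yield the last equation at `y` itself, but by linear algebra it yields a vector `v` along which all
energies are constant such that the equation holds at `y + v` (`exists_flat_direction`), where the
infimum is attained as well.
-/

namespace MET

open Real Finset

set_option linter.unusedSectionVars false

/-! ### Factorials and binomial coefficients up to polynomial factors -/

theorem le_log_factorial (n : ℕ) : -negMulLog n - n ≤ log (n.factorial : ℝ) := by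
  have hf : (0 : ℝ) < n.factorial := by exact_mod_cast n.factorial_pos
  rcases Nat.eq_zero_or_pos n with rfl | hn
  · simp
  have h := pow_div_factorial_le_exp (x := (n : ℝ)) (by positivity) n
  have hn' : (0 : ℝ) < n := by exact_mod_cast hn
  have h2 := Real.log_le_log (by positivity) h
  rw [Real.log_div (by positivity) hf.ne', Real.log_pow, Real.log_exp] at h2
  simp only [negMulLog]
  linarith

theorem log_factorial_le (n : ℕ) :
    log (n.factorial : ℝ) ≤ -negMulLog n - n + (1 + log (n + 1)) := by
  have key : ∀ k : ℕ, log ((k + 1).factorial : ℝ) ≤ (k + 2) * log (k + 1) - k := by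
    intro k
    induction k with
    | zero => simp
    | succ k ih =>
      have h1 : (0 : ℝ) < k + 1 := by positivity
      have h2 : (0 : ℝ) < k + 2 := by positivity
      have hf : (0 : ℝ) < (k + 1).factorial := by exact_mod_cast Nat.factorial_pos _
      rw [Nat.factorial_succ, Nat.cast_mul, Real.log_mul (by positivity) hf.ne']
      push_cast
      have h3 : 1 - ((k + 2 : ℝ) / (k + 1))⁻¹ ≤ log ((k + 2 : ℝ) / (k + 1)) :=
        Real.one_sub_inv_le_log_of_pos (by positivity)
      rw [Real.log_div h2.ne' h1.ne', inv_div] at h3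
      have h4 : 1 ≤ (k + 2 : ℝ) * (log (k + 2) - log (k + 1)) := by
        have h5 := mul_le_mul_of_nonneg_left h3 h2.le
        have h6 : (k + 2 : ℝ) * (1 - (k + 1) / (k + 2)) = 1 := by field_simp; ring
        linarith
      have e : (k : ℝ) + 1 + 1 = k + 2 := by ring
      rw [e]
      nlinarith
  rcases n with _ | k
  · simp
  have h := key k
  have hl : log ((k : ℝ) + 1) ≤ log ((k : ℝ) + 1 + 1) :=
    Real.log_le_log (by positivity) (by linarith)
  simp only [negMulLog]
  push_cast
  nlinarith

/-- Stirling's formula with a logarithmic error for binomial coefficients. -/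
theorem abs_log_choose_sub_le {N E : ℕ} (h : E ≤ N) (hN : 0 < N) :
    |log (N.choose E : ℝ) - N * binEntropy (E / N)| ≤ 2 * (1 + log (N + 1)) := by
  have hE1 := le_log_factorial E
  have hE2 := log_factorial_le E
  have hN1 := le_log_factorial N
  have hN2 := log_factorial_le N
  have hM1 := le_log_factorial (N - E)
  have hM2 := log_factorial_le (N - E)
  rw [Nat.cast_sub h] at hM1 hM2
  have hN' : (0 : ℝ) < N := by exact_mod_cast hN
  have hEN : (E : ℝ) ≤ N := by exact_mod_cast h
  have e1 : (N : ℝ) * binEntropy (E / N) =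
      negMulLog E + negMulLog (N - E) - negMulLog N := by
    rw [binEntropy_eq_negMulLog_add_negMulLog_one_sub]
    have h1 : negMulLog (E : ℝ) = negMulLog ((N : ℝ) * (E / N)) := by
      congr 1; field_simp
    have h2 : negMulLog ((N : ℝ) - E) = negMulLog ((N : ℝ) * (1 - E / N)) := by
      congr 1; field_simp
    rw [h1, h2, negMulLog_mul, negMulLog_mul]
    ring
  have e2 : log (N.choose E : ℝ) = log (N.factorial : ℝ) - log (E.factorial : ℝ)
      - log ((N - E).factorial : ℝ) := by
    have hc := Nat.choose_mul_factorial_mul_factorial h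
    have hc' : (N.choose E : ℝ) * E.factorial * (N - E).factorial = N.factorial := by
      exact_mod_cast hc
    have p1 : (N.choose E : ℝ) ≠ 0 := by exact_mod_cast (Nat.choose_pos h).ne'
    have p2 : (E.factorial : ℝ) ≠ 0 := by exact_mod_cast E.factorial_ne_zero
    have p3 : ((N - E).factorial : ℝ) ≠ 0 := by exact_mod_cast (N - E).factorial_ne_zero
    rw [← hc', Real.log_mul (mul_ne_zero p1 p2) p3, Real.log_mul p1 p2]
    ring
  have l1 : log ((E : ℝ) + 1) ≤ log (N + 1) := Real.log_le_log (by positivity) (by linarith)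
  have l2 : log ((N : ℝ) - E + 1) ≤ log (N + 1) := by
    have : (0 : ℝ) ≤ E := by positivity
    exact Real.log_le_log (by linarith) (by linarith)
  have l3 : 0 ≤ log ((N : ℝ) + 1) := Real.log_nonneg (by linarith)
  rw [abs_le, e1, e2]
  constructor <;> linarith

/-! ### Convex duality between partition functions and entropy -/

section Duality

variable {J : Type*} [Fintype J] {S : J → Type*} [∀ j, Fintype (S j)]
  {ι : Type*} [Fintype ι]

/-- The energy `⟨a, y⟩` of a state with exponent vector `a` at the point `y`. -/
def energy (a : ι → ℝ) (y : ι → ℝ) : ℝ := ∑ i, a i * y i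

/-- The partition function `∑_s exp ⟨a_s, y⟩` of one type of nodes. -/
noncomputable def partitionFn {T : Type*} [Fintype T] (a : T → ι → ℝ) (y : ι → ℝ) : ℝ :=
  ∑ s, exp (energy (a s) y)

/-- The logarithm of a product of partition functions over the node types `j`, with real
multiplicities `ρ j`. -/
noncomputable def logPartition (a : ∀ j, S j → ι → ℝ) (ρ : J → ℝ) (y : ι → ℝ) : ℝ :=
  ∑ j, ρ j * log (partitionFn (a j) y)

/-- The exponential growth rate of the number of assignments of states to nodes, when there are
`n * ρ j` nodes of type `j`, of which `n * p j s` are in the state `s`. -/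
noncomputable def profileEntropy (ρ : J → ℝ) (p : ∀ j, S j → ℝ) : ℝ :=
  ∑ j, ((∑ s, negMulLog (p j s)) - negMulLog (ρ j))

/-- The total exponent vector of a profile. -/
def moment (a : ∀ j, S j → ι → ℝ) (p : ∀ j, S j → ℝ) (i : ι) : ℝ :=
  ∑ j, ∑ s, p j s * a j s i

/-- The profiles with `ρ j` nodes of type `j`. -/
def profiles (S : J → Type*) [∀ j, Fintype (S j)] (ρ : J → ℝ) : Set (∀ j, S j → ℝ) :=
  {p | (∀ j s, 0 ≤ p j s) ∧ ∀ j, ∑ s, p j s = ρ j}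

/-- The Gibbs profile at `y`, the one of largest entropy with its moments. -/
noncomputable def gibbs (a : ∀ j, S j → ι → ℝ) (ρ : J → ℝ) (y : ι → ℝ) (j : J) (s : S j) : ℝ :=
  ρ j * exp (energy (a j s) y) / partitionFn (a j) y

variable (a : ∀ j, S j → ι → ℝ) {ρ : J → ℝ}

theorem partitionFn_pos {T : Type*} [Fintype T] [Nonempty T] (a : T → ι → ℝ) (y : ι → ℝ) :
    0 < partitionFn a y :=
  Finset.sum_pos (fun _ _ => exp_pos _) univ_nonempty

theorem moment_mul_eq (p : ∀ j, S j → ℝ) (y : ι → ℝ) :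
    ∑ i, moment a p i * y i = ∑ j, ∑ s, p j s * energy (a j s) y := by
  simp only [moment, energy, Finset.sum_mul, Finset.mul_sum]
  rw [Finset.sum_comm]
  refine Finset.sum_congr rfl fun j _ => ?_
  rw [Finset.sum_comm]
  refine Finset.sum_congr rfl fun s _ => Finset.sum_congr rfl fun i _ => by ring

theorem sum_negMulLog_add_le {T : Type*} [Fintype T] [Nonempty T] (g p : T → ℝ) {r : ℝ}
    (hr : 0 < r) (hp : ∀ s, 0 ≤ p s) (hs : ∑ s, p s = r) :
    (∑ s, negMulLog (p s)) - negMulLog r + ∑ s, p s * g s ≤ r * log (∑ s, exp (g s)) := by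
  set Z := ∑ s, exp (g s) with hZ
  have hZ0 : 0 < Z := Finset.sum_pos (fun _ _ => exp_pos _) univ_nonempty
  have key : ∀ s, negMulLog (p s) + p s * (g s + log r - log Z) ≤ r * exp (g s) / Z - p s := by
    intro s
    rcases (hp s).eq_or_lt with h | h
    · rw [← h]; simp; positivity
    have h1 : log (r * exp (g s) / Z / p s) ≤ r * exp (g s) / Z / p s - 1 :=
      log_le_sub_one_of_pos (by positivity)
    rw [log_div (by positivity) h.ne', log_div (by positivity) hZ0.ne',
      log_mul hr.ne' (exp_pos _).ne', log_exp] at h1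
    have h2 := mul_le_mul_of_nonneg_left h1 h.le
    have h3 : p s * (r * exp (g s) / Z / p s - 1) = r * exp (g s) / Z - p s := by
      field_simp
    simp only [negMulLog]
    linarith
  have hsum := Finset.sum_le_sum fun s (_ : s ∈ univ) => key s
  have e1 : ∑ s, (r * exp (g s) / Z - p s) = 0 := by
    rw [Finset.sum_sub_distrib, hs, ← Finset.sum_div, ← Finset.mul_sum, ← hZ]
    field_simp; ring
  have e2 : ∑ s, (negMulLog (p s) + p s * (g s + log r - log Z)) =
      (∑ s, negMulLog (p s)) + ∑ s, p s * g s + r * (log r - log Z) := by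
    have e3 : ∑ s, p s * (log r - log Z) = r * (log r - log Z) := by rw [← Finset.sum_mul, hs]
    rw [← e3, ← Finset.sum_add_distrib, ← Finset.sum_add_distrib]
    exact Finset.sum_congr rfl fun s _ => by ring
  rw [e1, e2] at hsum
  simp only [negMulLog] at hsum ⊢
  linarith

/-- Weak duality: Gibbs' inequality. -/
theorem profileEntropy_add_moment_le [∀ j, Nonempty (S j)] (hρ : ∀ j, 0 < ρ j)
    {p : ∀ j, S j → ℝ} (hp : p ∈ profiles S ρ) (y : ι → ℝ) :
    profileEntropy ρ p + ∑ i, moment a p i * y i ≤ logPartition a ρ y := by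
  rw [moment_mul_eq, profileEntropy, ← Finset.sum_add_distrib]
  exact Finset.sum_le_sum fun j _ =>
    sum_negMulLog_add_le (fun s => energy (a j s) y) (p j) (hρ j) (hp.1 j) (hp.2 j)

theorem gibbs_pos [∀ j, Nonempty (S j)] (hρ : ∀ j, 0 < ρ j) (y : ι → ℝ) (j : J) (s : S j) :
    0 < gibbs a ρ y j s := by
  have := hρ j
  have := partitionFn_pos (a j) y
  unfold gibbs
  positivity

theorem gibbs_mem [∀ j, Nonempty (S j)] (hρ : ∀ j, 0 < ρ j) (y : ι → ℝ) :
    gibbs a ρ y ∈ profiles S ρ := by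
  refine ⟨fun j s => (gibbs_pos a hρ y j s).le, fun j => ?_⟩
  have := partitionFn_pos (a j) y
  simp only [gibbs]
  rw [← Finset.sum_div, ← Finset.mul_sum]
  change ρ j * partitionFn (a j) y / partitionFn (a j) y = ρ j
  field_simp

theorem log_gibbs [∀ j, Nonempty (S j)] (hρ : ∀ j, 0 < ρ j) (y : ι → ℝ) (j : J) (s : S j) :
    log (gibbs a ρ y j s) = log (ρ j) + energy (a j s) y - log (partitionFn (a j) y) := by
  have h1 := hρ j
  have h2 := partitionFn_pos (a j) y
  rw [gibbs, log_div (by positivity) h2.ne', log_mul h1.ne' (exp_pos _).ne', log_exp]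

/-- Equality in Gibbs' inequality. -/
theorem profileEntropy_gibbs [∀ j, Nonempty (S j)] (hρ : ∀ j, 0 < ρ j) (y : ι → ℝ) :
    profileEntropy ρ (gibbs a ρ y) + ∑ i, moment a (gibbs a ρ y) i * y i =
      logPartition a ρ y := by
  rw [moment_mul_eq, profileEntropy, ← Finset.sum_add_distrib]
  refine Finset.sum_congr rfl fun j _ => ?_
  have h : ∀ s, negMulLog (gibbs a ρ y j s) = gibbs a ρ y j s *
      (log (partitionFn (a j) y) - log (ρ j)) - gibbs a ρ y j s * energy (a j s) y := by
    intro s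
    rw [negMulLog, log_gibbs a hρ]
    ring
  simp only [h]
  rw [Finset.sum_sub_distrib, ← Finset.sum_mul, (gibbs_mem a hρ y).2 j, negMulLog]
  ring

theorem energy_add_smul (b y v : ι → ℝ) (x : ℝ) :
    energy b (y + x • v) = energy b y + x * energy b v := by
  simp only [energy, Pi.add_apply, Pi.smul_apply, smul_eq_mul, mul_add, Finset.sum_add_distrib,
    Finset.mul_sum]
  congr 1
  exact Finset.sum_congr rfl fun i _ => by ring

theorem hasDerivAt_logPartition [∀ j, Nonempty (S j)] (y v : ι → ℝ) :
    HasDerivAt (fun x : ℝ => logPartition a ρ (y + x • v))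
      (∑ i, moment a (gibbs a ρ y) i * v i) 0 := by
  rw [moment_mul_eq]
  unfold logPartition
  refine HasDerivAt.fun_sum fun j _ => ?_
  have h1 : HasDerivAt (fun x : ℝ => partitionFn (a j) (y + x • v))
      (∑ s, exp (energy (a j s) y) * energy (a j s) v) 0 := by
    unfold partitionFn
    refine HasDerivAt.fun_sum fun s _ => ?_
    simp only [energy_add_smul]
    have h2 : HasDerivAt (fun x : ℝ => energy (a j s) y + x * energy (a j s) v)
        (energy (a j s) v) 0 := by
      simpa using ((hasDerivAt_id (0 : ℝ)).mul_const (energy (a j s) v)).const_add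
        (energy (a j s) y)
    simpa using h2.exp
  have h0 := partitionFn_pos (a j) y
  have h3 := (h1.log (by simpa using h0.ne')).const_mul (ρ j)
  refine h3.congr_deriv ?_
  simp only [zero_smul, add_zero, gibbs]
  rw [Finset.sum_div, Finset.mul_sum]
  exact Finset.sum_congr rfl fun s _ => by ring

/-- The derivative of the dual objective along a coordinate. -/
theorem hasDerivAt_dual [DecidableEq ι] [∀ j, Nonempty (S j)] (c y : ι → ℝ) (i : ι) :
    HasDerivAt (fun x : ℝ => logPartition a ρ (y + x • Pi.single i 1) -
      ∑ k, c k * (y + x • Pi.single i 1 : ι → ℝ) k) (moment a (gibbs a ρ y) i - c i) 0 := by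
  have hd1 := hasDerivAt_logPartition a (ρ := ρ) y (Pi.single i 1)
  have hd2 : HasDerivAt (fun x : ℝ => ∑ k, c k * (y + x • Pi.single i 1 : ι → ℝ) k)
      (c i) 0 := by
    have : (fun x : ℝ => ∑ k, c k * (y + x • Pi.single i 1 : ι → ℝ) k) =
        fun x => ∑ k, c k * y k + x * c i := by
      ext x
      simp [mul_add, Finset.sum_add_distrib, Pi.single_apply, mul_comm]
    rw [this]
    simpa using ((hasDerivAt_id (0 : ℝ)).mul_const (c i)).const_add (∑ k, c k * y k)
  refine (hd1.sub hd2).congr_deriv ?_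
  simp [Pi.single_apply]

theorem continuous_logPartition [∀ j, Nonempty (S j)] : Continuous (logPartition a ρ) := by
  unfold logPartition
  refine continuous_finsetSum _ fun j _ => continuous_const.mul ?_
  refine Continuous.log ?_ fun y => (partitionFn_pos (a j) y).ne'
  unfold partitionFn energy
  fun_prop

theorem continuous_profileEntropy : Continuous (profileEntropy ρ (S := S)) := by
  unfold profileEntropy
  have := continuous_negMulLog
  fun_prop

theorem continuous_moment (i : ι) : Continuous fun p => moment a p i := by
  unfold moment
  fun_prop

theorem isCompact_profiles : IsCompact (profiles S ρ) := by
  have hc : IsCompact (Set.univ.pi fun j => Set.univ.pi fun _ : S j => Set.Icc (0 : ℝ) (ρ j)) :=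
    isCompact_univ_pi fun j => isCompact_univ_pi fun _ => isCompact_Icc
  refine hc.of_isClosed_subset ?_ ?_
  · have h1 : IsClosed {p : ∀ j, S j → ℝ | ∀ j s, 0 ≤ p j s} := by
      simp only [Set.ofPred_forall]
      exact isClosed_iInter fun j => isClosed_iInter fun s =>
        isClosed_le continuous_const (by fun_prop)
    have h2 : IsClosed {p : ∀ j, S j → ℝ | ∀ j, ∑ s, p j s = ρ j} := by
      simp only [Set.ofPred_forall]
      exact isClosed_iInter fun j => isClosed_eq (by fun_prop) continuous_const
    exact h1.inter h2
  · intro p hp j _ s _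
    refine ⟨hp.1 j s, ?_⟩
    rw [← hp.2 j]
    exact Finset.single_le_sum (fun s _ => hp.1 j s) (mem_univ s)

theorem norm_sq_le_sum_sq (y : ι → ℝ) : ‖y‖ ^ 2 ≤ ∑ i, y i ^ 2 := by
  have h : ‖y‖ ≤ √(∑ i, y i ^ 2) := by
    refine (pi_norm_le_iff_of_nonneg (sqrt_nonneg _)).2 fun i => ?_
    refine abs_le_sqrt ?_
    exact Finset.single_le_sum (f := fun i => y i ^ 2) (fun i _ => sq_nonneg _) (mem_univ i)
  calc ‖y‖ ^ 2 ≤ √(∑ i, y i ^ 2) ^ 2 := by gcongr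
    _ = _ := sq_sqrt (Finset.sum_nonneg fun i _ => sq_nonneg _)

/-- A minimiser of the dual problem with the penalty `ε ‖y‖²`: its Gibbs profile satisfies the
moment constraints up to an error of order `√ε`. -/
theorem exists_profile_moment_close [∀ j, Nonempty (S j)] (hρ : ∀ j, 0 < ρ j) {c : ι → ℝ} {r : ℝ}
    (h : ∀ y, r ≤ logPartition a ρ y - ∑ i, c i * y i) {ε : ℝ} (hε : 0 < ε) :
    ∃ p ∈ profiles S ρ, r ≤ profileEntropy ρ p ∧
      ∑ i, (moment a p i - c i) ^ 2 ≤ 4 * ε * (logPartition a ρ 0 - r) := by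
  classical
  let f : (ι → ℝ) → ℝ := fun y => logPartition a ρ y - ∑ i, c i * y i
  let g : (ι → ℝ) → ℝ := fun y => f y + ε * ∑ i, y i ^ 2
  have hg : Continuous g := by
    have := continuous_logPartition a (ρ := ρ)
    fun_prop
  obtain ⟨y, hy⟩ : ∃ y, ∀ z, g y ≤ g z := by
    refine hg.exists_forall_le' 0 ?_
    have h1 : Tendsto (fun y : ι → ℝ => r + ε * ‖y‖ ^ 2) (cocompact _) atTop := by
      refine tendsto_atTop_add_const_left _ _ (Tendsto.const_mul_atTop hε ?_)
      exact (tendsto_pow_atTop two_ne_zero).comp tendsto_norm_cocompact_atTop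
    filter_upwards [h1.eventually_ge_atTop (g 0)] with z hz
    have h2 := mul_le_mul_of_nonneg_left (norm_sq_le_sum_sq z) hε.le
    have h3 := h z
    simp only [g, f] at hz ⊢
    linarith
  have hmom : ∀ i, moment a (gibbs a ρ y) i - c i = -(2 * ε * y i) := by
    intro i
    have hd3 : HasDerivAt (fun x : ℝ => ε * ∑ k, (y + x • Pi.single i 1 : ι → ℝ) k ^ 2)
        (2 * ε * y i) 0 := by
      have h1 : HasDerivAt (fun x : ℝ => ∑ k, (y + x • Pi.single i 1 : ι → ℝ) k ^ 2)
          (∑ k, 2 * y k * (Pi.single i 1 : ι → ℝ) k) 0 := by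
        refine HasDerivAt.fun_sum fun k _ => ?_
        have h2 : HasDerivAt (fun x : ℝ => (y + x • Pi.single i 1 : ι → ℝ) k)
            ((Pi.single i 1 : ι → ℝ) k) 0 := by
          simpa using ((hasDerivAt_id (0 : ℝ)).mul_const ((Pi.single i 1 : ι → ℝ) k)).const_add
            (y k)
        simpa using h2.fun_pow 2
      refine (h1.const_mul ε).congr_deriv ?_
      simp [Pi.single_apply]
      ring
    have hd := (hasDerivAt_dual a (ρ := ρ) c y i).add hd3
    have hmin : IsLocalMin (fun x : ℝ => g (y + x • Pi.single i 1)) 0 := by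
      refine Filter.Eventually.of_forall fun x => ?_
      simpa using hy (y + x • Pi.single i 1)
    have h0 := hmin.hasDerivAt_eq_zero hd
    linarith
  refine ⟨gibbs a ρ y, gibbs_mem a hρ y, ?_, ?_⟩
  · have h1 := profileEntropy_gibbs a hρ y
    have h2 : ∑ i, moment a (gibbs a ρ y) i * y i =
        ∑ i, c i * y i - 2 * ε * ∑ i, y i ^ 2 := by
      rw [Finset.mul_sum, ← Finset.sum_sub_distrib]
      refine Finset.sum_congr rfl fun i _ => ?_
      linear_combination (y i) * hmom i
    have h3 := h y
    have h4 : 0 ≤ 2 * ε * ∑ i, y i ^ 2 := by positivity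
    linarith
  · have h1 := hy 0
    have h2 := h y
    simp only [g, f] at h1
    simp at h1
    have h3 : ∑ i, (moment a (gibbs a ρ y) i - c i) ^ 2 = 4 * ε * (ε * ∑ i, y i ^ 2) := by
      simp only [hmom, Finset.mul_sum]
      exact Finset.sum_congr rfl fun i _ => by ring
    rw [h3]
    refine mul_le_mul_of_nonneg_left ?_ (by positivity)
    linarith

/-- Strong duality: a lower bound of the dual problem is a lower bound of the largest entropy of a
profile with the prescribed moments. No attainment in the dual problem is needed. -/
theorem exists_profile_entropy_ge [∀ j, Nonempty (S j)] (hρ : ∀ j, 0 < ρ j) {c : ι → ℝ} {r : ℝ}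
    (h : ∀ y, r ≤ logPartition a ρ y - ∑ i, c i * y i) :
    ∃ p ∈ profiles S ρ, r ≤ profileEntropy ρ p ∧ ∀ i, moment a p i = c i := by
  have hK : IsCompact (profiles S ρ ∩ {p | r ≤ profileEntropy ρ p}) :=
    isCompact_profiles.inter_right (isClosed_le continuous_const continuous_profileEntropy)
  obtain ⟨p₁, hp₁, hr₁, -⟩ := exists_profile_moment_close a hρ h one_pos
  have hcont : Continuous fun p => ∑ i, (moment a p i - c i) ^ 2 :=
    continuous_finsetSum _ fun i _ => ((continuous_moment a i).sub continuous_const).pow 2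
  obtain ⟨p, ⟨hp, hpr⟩, hmin⟩ := hK.exists_isMinOn ⟨p₁, hp₁, hr₁⟩ hcont.continuousOn
  refine ⟨p, hp, hpr, ?_⟩
  have hC : 0 ≤ logPartition a ρ 0 - r := by
    have := h 0
    simp at this
    linarith
  have hle : ∑ i, (moment a p i - c i) ^ 2 ≤ 0 := by
    refine le_of_forall_pos_le_add fun δ hδ => ?_
    obtain ⟨q, hq, hqr, hqm⟩ := exists_profile_moment_close a hρ h
      (ε := δ / (4 * (logPartition a ρ 0 - r + 1))) (by positivity)
    refine (hmin ⟨hq, hqr⟩).trans (hqm.trans ?_)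
    have : 4 * (δ / (4 * (logPartition a ρ 0 - r + 1))) * (logPartition a ρ 0 - r) =
        δ * ((logPartition a ρ 0 - r) / (logPartition a ρ 0 - r + 1)) := by
      field_simp
    rw [this, zero_add]
    refine mul_le_of_le_one_right hδ.le ?_
    rw [div_le_one (by linarith)]
    linarith
  intro i
  have h1 := Finset.single_le_sum (f := fun i => (moment a p i - c i) ^ 2)
    (fun i _ => sq_nonneg _) (mem_univ i)
  have h2 : (moment a p i - c i) ^ 2 ≤ 0 := h1.trans hle
  exact sub_eq_zero.1 (pow_eq_zero_iff two_ne_zero |>.1 (le_antisymm h2 (sq_nonneg _)))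

end Duality

/-! ### Integer points of dilated polytopes -/

section Lattice

variable {X R : Type*} [Fintype X] (L : R → X → ℤ)

/-- The real solutions of a homogeneous linear system with integer coefficients are spanned by its
integer solutions: expand the coordinates of a real solution in a basis of `ℝ` over `ℚ`. -/
theorem mem_span_int_solutions {w : X → ℝ} (hw : ∀ r, ∑ x, (L r x : ℝ) * w x = 0) :
    w ∈ Submodule.span ℝ
      {v : X → ℝ | ∃ k : X → ℤ, (∀ r, ∑ x, L r x * k x = 0) ∧ v = fun x => (k x : ℝ)} := by
  classical
  let B := Module.Basis.ofVectorSpace ℚ ℝ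
  set I : Finset _ := univ.biUnion fun x => (B.repr (w x)).support with hI
  have hw_eq : w = ∑ b ∈ I, (B b : ℝ) • fun x => ((B.repr (w x) b : ℚ) : ℝ) := by
    ext x
    rw [Finset.sum_apply]
    conv_lhs => rw [← B.linearCombination_repr (w x)]
    rw [Finsupp.linearCombination_apply, Finsupp.sum_of_support_subset (s := I)]
    · refine Finset.sum_congr rfl fun b _ => ?_
      simp only [Pi.smul_apply, smul_eq_mul, Rat.smul_def]
      ring
    · rw [hI]
      exact Finset.subset_biUnion_of_mem (fun x => (B.repr (w x)).support) (mem_univ x)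
    · simp
  rw [hw_eq]
  refine Submodule.sum_mem _ fun b _ => Submodule.smul_mem _ _ ?_
  have hq : ∀ r, ∑ x, (L r x : ℚ) * B.repr (w x) b = 0 := by
    intro r
    have h1 : B.repr (∑ x, (L r x : ℚ) • w x) b = 0 := by
      have : ∑ x, (L r x : ℚ) • w x = 0 := by
        rw [← hw r]
        refine Finset.sum_congr rfl fun x _ => ?_
        rw [Rat.smul_def]; simp
      rw [this]; simp
    simpa [map_sum, Finsupp.finsetSum_apply] using h1
  -- clearing denominators
  set q : X → ℚ := fun x => B.repr (w x) b with hqdef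
  set N : ℕ := ∏ x, (q x).den with hN
  have hN0 : (N : ℚ) ≠ 0 := by
    rw [hN]
    exact_mod_cast Finset.prod_ne_zero_iff.2 fun x _ => (q x).den_ne_zero
  have hk : ∀ x, ∃ k : ℤ, (k : ℚ) = N * q x := by
    intro x
    obtain ⟨c, hc⟩ := Finset.dvd_prod_of_mem (fun x => (q x).den) (mem_univ x)
    refine ⟨c * (q x).num, ?_⟩
    rw [hN, hc]
    push_cast
    rw [mul_comm ((q x).den : ℚ), mul_assoc, Rat.den_mul_eq_num]
  choose k hk using hk
  have hqk : (fun x => ((q x : ℚ) : ℝ)) = ((N : ℝ)⁻¹) • fun x => (k x : ℝ) := by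
    ext x
    have h1 : q x = (N : ℚ)⁻¹ * k x := by rw [hk]; field_simp
    simp only [Pi.smul_apply, smul_eq_mul]
    rw [h1]; push_cast; rfl
  change (fun x => ((q x : ℚ) : ℝ)) ∈ _
  rw [hqk]
  refine Submodule.smul_mem _ _ (Submodule.subset_span ⟨k, fun r => ?_, rfl⟩)
  have : ((∑ x, L r x * k x : ℤ) : ℚ) = 0 := by
    push_cast
    simp only [hk]
    have h2 := hq r
    calc ∑ x, (L r x : ℚ) * (N * q x) = N * ∑ x, (L r x : ℚ) * q x := by
          rw [Finset.mul_sum]; exact Finset.sum_congr rfl fun x _ => by ring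
      _ = 0 := by rw [h2, mul_zero]
  exact_mod_cast this

/-- Real solutions of an integral homogeneous system are at bounded distance from integer ones. -/
theorem exists_int_solution_near : ∃ C : ℝ, 0 ≤ C ∧ ∀ w : X → ℝ,
    (∀ r, ∑ x, (L r x : ℝ) * w x = 0) →
      ∃ k : X → ℤ, (∀ r, ∑ x, L r x * k x = 0) ∧ ∀ x, |(k x : ℝ) - w x| ≤ C := by
  classical
  set V : Set (X → ℝ) :=
    {v : X → ℝ | ∃ k : X → ℤ, (∀ r, ∑ x, L r x * k x = 0) ∧ v = fun x => (k x : ℝ)} with hV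
  obtain ⟨b, hbV, hspan, hli⟩ := exists_linearIndependent ℝ V
  have hfin : b.Finite := LinearIndependent.setFinite hli
  choose! κ hκ1 hκ2 using fun v (hv : v ∈ b) => hbV hv
  refine ⟨∑ v ∈ hfin.toFinset, ‖v‖, Finset.sum_nonneg fun _ _ => norm_nonneg _, fun w hw => ?_⟩
  have hmem := mem_span_int_solutions L hw
  rw [← hV, ← hspan, ← hfin.coe_toFinset, Submodule.mem_span_finset] at hmem
  obtain ⟨f, -, hf⟩ := hmem
  refine ⟨fun x => ∑ v ∈ hfin.toFinset, ⌊f v⌋ * κ v x, fun r => ?_, fun x => ?_⟩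
  · simp only [Finset.mul_sum]
    rw [Finset.sum_comm]
    refine Finset.sum_eq_zero fun v hv => ?_
    have h1 := hκ1 v (hfin.mem_toFinset.1 hv) r
    calc ∑ x, L r x * (⌊f v⌋ * κ v x) = ⌊f v⌋ * ∑ x, L r x * κ v x := by
          rw [Finset.mul_sum]; exact Finset.sum_congr rfl fun x _ => by ring
      _ = 0 := by rw [h1, mul_zero]
  · rw [← hf]
    push_cast
    rw [Finset.sum_apply, ← Finset.sum_sub_distrib]
    refine (Finset.abs_sum_le_sum_abs _ _).trans (Finset.sum_le_sum fun v hv => ?_)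
    have h1 : ((κ v x : ℤ) : ℝ) = v x := (congrFun (hκ2 v (hfin.mem_toFinset.1 hv)) x).symm
    rw [h1, Pi.smul_apply, smul_eq_mul, ← sub_mul, abs_mul]
    have h2 : |(⌊f v⌋ : ℝ) - f v| ≤ 1 := by
      rw [abs_le]
      constructor <;> linarith [Int.floor_le (f v), Int.lt_floor_add_one (f v)]
    calc |(⌊f v⌋ : ℝ) - f v| * |v x| ≤ 1 * ‖v‖ :=
          mul_le_mul h2 (norm_le_pi_norm v x) (abs_nonneg _) zero_le_one
      _ = ‖v‖ := one_mul _

/-- If the `n`-th dilate of the polytope `{z ≥ 0, L z = b}` has an integer point at all, then its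
integer points come close to `n z` for each point `z` of the polytope, uniformly in the large `n`.
The existing integer point supplies the right residue class; moving `z` slightly into the relative
interior leaves room for rounding. -/
theorem exists_nat_point_near (b : R → ℝ) {z : X → ℝ} (hz0 : ∀ x, 0 ≤ z x)
    (hz : ∀ r, ∑ x, (L r x : ℝ) * z x = b r) {δ : ℝ} (hδ : 0 < δ) :
    ∃ n₀ : ℕ, ∀ n ≥ n₀, 0 < n → ∀ k₀ : X → ℕ, (∀ r, ∑ x, (L r x : ℝ) * k₀ x = n * b r) →
      ∃ k : X → ℕ, (∀ r, ∑ x, (L r x : ℝ) * k x = n * b r) ∧ ∀ x, |(k x : ℝ) / n - z x| ≤ δ := by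
  classical
  let K : Set (X → ℝ) := {z | (∀ x, 0 ≤ z x) ∧ ∀ r, ∑ x, (L r x : ℝ) * z x = b r}
  -- a point of the polytope with the largest possible support
  obtain ⟨T, ⟨p, hpK, rfl⟩, hT⟩ : ∃ T ∈ {T : Finset X | ∃ p ∈ K, T = univ.filter fun x => p x ≠ 0},
      ∀ T' ∈ {T : Finset X | ∃ p ∈ K, T = univ.filter fun x => p x ≠ 0}, T'.card ≤ T.card := by
    have hne : {T : Finset X | ∃ p ∈ K, T = univ.filter fun x => p x ≠ 0}.Nonempty :=
      ⟨_, z, ⟨hz0, hz⟩, rfl⟩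
    obtain ⟨T, hT, hmax⟩ := Set.exists_max_image _ Finset.card (Set.toFinite _) hne
    exact ⟨T, hT, hmax⟩
  have hcomb : ∀ s ∈ K, ∀ θ : ℝ, 0 ≤ θ → θ ≤ 1 → (fun x => (1 - θ) * s x + θ * p x) ∈ K := by
    intro s hs θ h0 h1
    refine ⟨fun x => ?_, fun r => ?_⟩
    · have := hs.1 x
      have := hpK.1 x
      have : 0 ≤ 1 - θ := by linarith
      positivity
    · have e : ∑ x, (L r x : ℝ) * ((1 - θ) * s x + θ * p x) =
          (1 - θ) * ∑ x, (L r x : ℝ) * s x + θ * ∑ x, (L r x : ℝ) * p x := by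
        rw [Finset.mul_sum, Finset.mul_sum, ← Finset.sum_add_distrib]
        exact Finset.sum_congr rfl fun x _ => by ring
      rw [e, hs.2 r, hpK.2 r]; ring
  have hsupp : ∀ s ∈ K, ∀ x, p x = 0 → s x = 0 := by
    intro s hs x hx
    by_contra hsx
    have hm := hT _ ⟨_, hcomb s hs (1 / 2) (by norm_num) (by norm_num), rfl⟩
    refine absurd hm (not_le.2 (Finset.card_lt_card ?_))
    rw [Finset.ssubset_iff_of_subset]
    · exact ⟨x, by simp [hx, hsx]; norm_num, by simp [hx]⟩
    · intro x' hx'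
      simp only [Finset.mem_filter, mem_univ, true_and] at hx' ⊢
      have h1 := hs.1 x'
      have h2 : 0 < p x' := lt_of_le_of_ne (hpK.1 x') (Ne.symm hx')
      positivity
  -- the interior point `z'` near `z`
  obtain ⟨D, hD⟩ : ∃ D : ℝ, ∀ x, |p x - z x| ≤ D :=
    ⟨‖p - z‖, fun x => norm_le_pi_norm (p - z) x⟩
  obtain ⟨D0, hDpos⟩ : ∃ D' : ℝ, 0 ≤ D' ∧ ∀ x, |p x - z x| ≤ D' :=
    ⟨max D 0, le_max_right _ _, fun x => (hD x).trans (le_max_left _ _)⟩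
  obtain ⟨hD0, hD⟩ := hDpos
  set θ : ℝ := min 1 (δ / (2 * (D0 + 1))) with hθ
  have hθ0 : 0 < θ := lt_min one_pos (by positivity)
  have hθ1 : θ ≤ 1 := min_le_left _ _
  set z' : X → ℝ := fun x => (1 - θ) * z x + θ * p x with hz'
  have hz'K : z' ∈ K := hcomb z ⟨hz0, hz⟩ θ hθ0.le hθ1
  have hzz' : ∀ x, |z' x - z x| ≤ δ / 2 := by
    intro x
    have e : z' x - z x = θ * (p x - z x) := by rw [hz']; ring
    rw [e, abs_mul, abs_of_pos hθ0]
    calc θ * |p x - z x| ≤ (δ / (2 * (D0 + 1))) * (D0 + 1) :=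
          mul_le_mul (min_le_right _ _) ((hD x).trans (by linarith)) (abs_nonneg _) (by positivity)
      _ = δ / 2 := by field_simp
  obtain ⟨η, hη0, hη⟩ : ∃ η : ℝ, 0 < η ∧ ∀ x, p x ≠ 0 → η ≤ p x := by
    rcases (univ.filter fun x => p x ≠ 0).eq_empty_or_nonempty with h | h
    · refine ⟨1, one_pos, fun x hx => ?_⟩
      have : x ∈ univ.filter fun x => p x ≠ 0 := by simp [hx]
      simp [h] at this
    · obtain ⟨x, hx, hmin⟩ := Finset.exists_min_image _ p h
      have hx' : p x ≠ 0 := by simpa using hx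
      exact ⟨p x, lt_of_le_of_ne (hpK.1 x) (Ne.symm hx'), fun y hy => hmin y (by simp [hy])⟩
  -- rounding inside the affine hull
  obtain ⟨C, hC0, hC⟩ := exists_int_solution_near (R := R ⊕ {x // p x = 0})
    (Sum.elim L fun x => Pi.single x.1 1)
  obtain ⟨n₀, hn₀⟩ := exists_nat_ge (C / (θ * η) + 2 * C / δ)
  refine ⟨n₀, fun n hn hnpos k₀ hk₀ => ?_⟩
  have hn' : (0 : ℝ) < n := by exact_mod_cast hnpos
  have hnge : C / (θ * η) + 2 * C / δ ≤ n := hn₀.trans (by exact_mod_cast hn)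
  have hn1 : C ≤ n * (θ * η) := by
    have : C / (θ * η) ≤ n := le_trans (le_add_of_nonneg_right (by positivity)) hnge
    rwa [div_le_iff₀ (by positivity)] at this
  have hn2 : C ≤ n * (δ / 2) := by
    have : 2 * C / δ ≤ n := le_trans (le_add_of_nonneg_left (by positivity)) hnge
    rw [div_le_iff₀ hδ] at this
    linarith
  have hk₀K : (fun x => (k₀ x : ℝ) / n) ∈ K := by
    refine ⟨fun x => by positivity, fun r => ?_⟩
    have h1 := hk₀ r
    have e : ∑ x, (L r x : ℝ) * ((k₀ x : ℝ) / n) = (∑ x, (L r x : ℝ) * k₀ x) / n := by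
      rw [Finset.sum_div]; exact Finset.sum_congr rfl fun x _ => by ring
    rw [e, h1]; field_simp
  have hk₀0 : ∀ x, p x = 0 → (k₀ x : ℝ) = 0 := by
    intro x hx
    have h1 := hsupp _ hk₀K x hx
    simpa [hn'.ne'] using h1
  obtain ⟨v, hv, hvC⟩ := hC (fun x => n * z' x - k₀ x) (by
    rintro (r | ⟨x, hx⟩)
    · have e : ∑ x, (L r x : ℝ) * (n * z' x - k₀ x) =
          n * ∑ x, (L r x : ℝ) * z' x - ∑ x, (L r x : ℝ) * k₀ x := by
        rw [Finset.mul_sum, ← Finset.sum_sub_distrib]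
        exact Finset.sum_congr rfl fun x _ => by ring
      simp only [Sum.elim_inl]
      rw [e, hz'K.2 r, hk₀ r, sub_self]
    · simp [Pi.single_apply, hsupp _ hz'K x hx, hk₀0 x hx])
  have hv0 : ∀ x, p x = 0 → v x = 0 := by
    intro x hx
    simpa [Pi.single_apply] using hv (Sum.inr ⟨x, hx⟩)
  have hnonneg : ∀ x, 0 ≤ (k₀ x : ℤ) + v x := by
    intro x
    by_cases hx : p x = 0
    · rw [hv0 x hx]; positivity
    · have h1 := (abs_le.1 (hvC x)).1
      have h2 : θ * η ≤ z' x := by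
        have h3 : 0 ≤ (1 - θ) * z x := mul_nonneg (by linarith) (hz0 x)
        have h4 := mul_le_mul_of_nonneg_left (hη x hx) hθ0.le
        simp only [hz']
        linarith
      have h3 := mul_le_mul_of_nonneg_left h2 hn'.le
      have : (0 : ℝ) ≤ (k₀ x : ℝ) + v x := by linarith
      exact_mod_cast this
  have hcast : ∀ x, ((((k₀ x : ℤ) + v x).toNat : ℕ) : ℝ) = k₀ x + v x := by
    intro x
    have h1 : (((((k₀ x : ℤ) + v x).toNat : ℕ) : ℤ) : ℝ) = ((k₀ x + v x : ℤ) : ℝ) := by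
      rw [Int.toNat_of_nonneg (hnonneg x)]
    push_cast at h1
    exact h1
  refine ⟨fun x => ((k₀ x : ℤ) + v x).toNat, fun r => ?_, fun x => ?_⟩
  · simp only [hcast, mul_add, Finset.sum_add_distrib]
    have h1 : ∑ x, (L r x : ℝ) * v x = 0 := by exact_mod_cast hv (Sum.inl r)
    rw [hk₀ r, h1, add_zero]
  · rw [hcast]
    have e : ((k₀ x : ℝ) + v x) / n - z x = (v x - (n * z' x - k₀ x)) / n + (z' x - z x) := by
      field_simp; ring
    have h1 : |((v x : ℝ) - (n * z' x - k₀ x)) / n| ≤ δ / 2 := by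
      rw [abs_div, abs_of_pos hn', div_le_iff₀ hn']
      linarith [hvC x]
    rw [e]
    exact (abs_add_le _ _).trans (by linarith [hzz' x])

end Lattice

/-! ### Counting labellings and matchings -/

section Labellings

variable {α β T : Type*} [Fintype α] [Fintype β] [Fintype T]

theorem exists_labelling (k : T → ℕ) (hk : ∑ s, k s = Fintype.card α) :
    ∃ f : α → T, ∀ s, Nat.card {v // f v = s} = k s := by
  have e : α ≃ Σ s, Fin (k s) := Fintype.equivOfCardEq (by simp [hk])
  refine ⟨fun v => (e v).1, fun s => ?_⟩
  have e2 : {v // (e v).1 = s} ≃ {w : Σ s, Fin (k s) // w.1 = s} :=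
    e.subtypeEquiv fun _ => Iff.rfl
  have e3 : {w : Σ s, Fin (k s) // w.1 = s} ≃ Fin (k s) :=
    Equiv.sigmaSubtype s
  rw [Nat.card_congr (e2.trans e3), Nat.card_eq_fintype_card, Fintype.card_fin]

/-- The permutations that preserve a labelling. -/
theorem card_perm_comp_eq (f : α → T) :
    Nat.card {g : Equiv.Perm α // f ∘ g = f} = ∏ s, (Nat.card {v // f v = s}).factorial := by
  classical
  rw [Nat.card_eq_fintype_card, DomMulAct.stabilizer_card]
  simp [Nat.card_eq_fintype_card]

/-- Two labellings with the same number of elements of each label are matched by as many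
bijections as there are permutations preserving one of them. -/
theorem card_equiv_comp_eq (f : α → T) (g : β → T)
    (h : ∀ s, Nat.card {v // f v = s} = Nat.card {w // g w = s}) :
    Nat.card {e : α ≃ β // g ∘ e = f} = ∏ s, (Nat.card {v // f v = s}).factorial := by
  rw [← card_perm_comp_eq]
  let e₀ : α ≃ β := Equiv.ofFiberEquiv fun s => (Finite.card_eq.1 (h s)).some
  have he₀ : ∀ v, g (e₀ v) = f v := fun v => Equiv.ofFiberEquiv_map _ v
  refine Nat.card_congr
    ((Equiv.equivCongr (Equiv.refl α) e₀.symm).subtypeEquiv fun e => ?_)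
  constructor <;> intro H <;> funext v
  · have h1 : g (e v) = f v := congrFun H v
    have h2 := he₀ (e₀.symm (e v))
    rw [e₀.apply_symm_apply] at h2
    change f (e₀.symm (e v)) = f v
    rw [← h2, h1]
  · have h1 : f (e₀.symm (e v)) = f v := congrFun H v
    rw [← he₀, e₀.apply_symm_apply] at h1
    exact h1

theorem factorial_card_le (k : T → ℕ) (hk : ∑ s, k s = Fintype.card α) :
    (Fintype.card α).factorial ≤
      Nat.card {f : α → T // ∀ s, Nat.card {v // f v = s} = k s} * ∏ s, (k s).factorial := by
  classical
  obtain ⟨f₀, hf₀⟩ := exists_labelling k hk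
  let φ : Equiv.Perm α → {f : α → T // ∀ s, Nat.card {v // f v = s} = k s} := fun g =>
    ⟨f₀ ∘ g, fun s => by
      rw [← hf₀ s]
      exact Nat.card_congr (g.subtypeEquiv fun _ => Iff.rfl)⟩
  have h1 : (univ : Finset (Equiv.Perm α)).card ≤
      (∏ s, (k s).factorial) *
        (univ : Finset {f : α → T // ∀ s, Nat.card {v // f v = s} = k s}).card := by
    refine Finset.card_le_mul_card_image_of_maps_to (f := φ) (fun _ _ => mem_univ _) _ ?_
    intro f _
    have h2 : Nat.card {e : Equiv.Perm α // f₀ ∘ e = f.1} = ∏ s, (k s).factorial := by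
      rw [card_equiv_comp_eq f.1 f₀ fun s => by rw [hf₀, f.2 s]]
      simp only [f.2]
    rw [← h2, Nat.card_eq_fintype_card, Fintype.card_subtype]
    refine Finset.card_le_card fun e he => ?_
    simp only [Finset.mem_filter, mem_univ, true_and] at he ⊢
    rw [← he]
  rw [Finset.card_univ, Finset.card_univ, Fintype.card_perm] at h1
  rw [Nat.card_eq_fintype_card]
  linarith

end Labellings

section Assignments

variable {J : Type*} [Fintype J] {S : J → Type*} [∀ j, Fintype (S j)] {ι : Type*} [Fintype ι]
  {N : J → ℕ}

/-- An assignment of states to the nodes, with `N j` nodes of type `j`. -/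
abbrev Assignment (S : J → Type*) (N : J → ℕ) : Type _ := ∀ v : (Σ j, Fin (N j)), S v.1

/-- The sum of the exponent vectors of all nodes. -/
def Assignment.total (a : ∀ j, S j → ι → ℕ) (A : Assignment S N) (i : ι) : ℕ :=
  ∑ v, a v.1 (A v) i

variable (a : ∀ j, S j → ι → ℕ)

theorem sum_exp_total [DecidableEq J] (y : ι → ℝ) :
    ∑ A : Assignment S N, exp (∑ i, (A.total a i : ℝ) * y i) =
      ∏ j, partitionFn (fun s i => (a j s i : ℝ)) y ^ N j := by
  have h1 : ∀ A : Assignment S N, exp (∑ i, (A.total a i : ℝ) * y i) =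
      ∏ v, exp (energy (fun i => (a v.1 (A v) i : ℝ)) y) := by
    intro A
    rw [← exp_sum]
    congr 1
    simp only [Assignment.total, energy, Nat.cast_sum, Finset.sum_mul]
    exact Finset.sum_comm
  simp only [h1]
  rw [← Fintype.prod_sum (fun (v : Σ j, Fin (N j)) (s : S v.1) =>
    exp (energy (fun i => (a v.1 s i : ℝ)) y)), Fintype.prod_sigma]
  refine Finset.prod_congr rfl fun j _ => ?_
  change ∏ _i : Fin (N j), partitionFn (fun s i => (a j s i : ℝ)) y = _
  simp

/-- The coefficients of a generating function are at most its values. -/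
theorem log_card_total_add_le [∀ j, Nonempty (S j)] (c : ι → ℕ) (y : ι → ℝ)
    (h : 0 < Nat.card {A : Assignment S N // ∀ i, A.total a i = c i}) :
    log (Nat.card {A : Assignment S N // ∀ i, A.total a i = c i}) + ∑ i, (c i : ℝ) * y i ≤
      ∑ j, (N j : ℝ) * log (partitionFn (fun s i => (a j s i : ℝ)) y) := by
  classical
  have hpos : ∀ j, 0 < partitionFn (fun s i => (a j s i : ℝ)) y := fun j => partitionFn_pos _ y
  have h1 : (Nat.card {A : Assignment S N // ∀ i, A.total a i = c i} : ℝ) *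
      exp (∑ i, (c i : ℝ) * y i) ≤ ∏ j, partitionFn (fun s i => (a j s i : ℝ)) y ^ N j := by
    rw [← sum_exp_total, Nat.card_eq_fintype_card, Fintype.card_subtype, ← nsmul_eq_mul,
      ← Finset.sum_const]
    calc _ = ∑ A ∈ univ.filter (fun A : Assignment S N => ∀ i, A.total a i = c i),
          exp (∑ i, (A.total a i : ℝ) * y i) := by
          refine Finset.sum_congr rfl fun A hA => ?_
          simp only [Finset.mem_filter, mem_univ, true_and] at hA
          simp only [hA]
      _ ≤ _ := Finset.sum_le_sum_of_subset_of_nonneg (Finset.filter_subset _ _)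
          fun _ _ _ => (exp_pos _).le
  have h' : (0 : ℝ) < Nat.card {A : Assignment S N // ∀ i, A.total a i = c i} := by
    exact_mod_cast h
  have h2 := log_le_log (by positivity) h1
  rw [log_mul h'.ne' (exp_pos _).ne', log_exp, log_prod fun j _ => (pow_pos (hpos j) _).ne'] at h2
  simpa only [log_pow] using h2

theorem Assignment.total_eq_sum_profile (A : Assignment S N) (i : ι) :
    A.total a i = ∑ j, ∑ s, Nat.card {v : Fin (N j) // (A ⟨j, v⟩ : S j) = s} * a j s i := by
  classical
  rw [Assignment.total, Fintype.sum_sigma]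
  refine Finset.sum_congr rfl fun j _ => ?_
  let f : Fin (N j) → S j := fun v => A ⟨j, v⟩
  rw [← Finset.sum_fiberwise univ f]
  refine Finset.sum_congr rfl fun s _ => ?_
  rw [Nat.card_eq_fintype_card, Fintype.card_subtype, ← smul_eq_mul, ← Finset.sum_const]
  refine Finset.sum_congr rfl fun v hv => ?_
  simp only [Finset.mem_filter, mem_univ, true_and] at hv
  rw [← hv]

theorem Assignment.sum_profile (A : Assignment S N) (j : J) :
    ∑ s : S j, Nat.card {v : Fin (N j) // (A ⟨j, v⟩ : S j) = s} = N j := by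
  classical
  let f : Fin (N j) → S j := fun v => A ⟨j, v⟩
  have h := Finset.card_eq_sum_card_fiberwise (f := f) (s := univ) (t := univ) fun _ _ => mem_univ _
  rw [Finset.card_univ, Fintype.card_fin] at h
  refine Eq.trans (Finset.sum_congr rfl fun s _ => ?_) h.symm
  rw [Nat.card_eq_fintype_card, Fintype.card_subtype]

theorem prod_factorial_le (k : ∀ j, S j → ℕ) (hk : ∀ j, ∑ s, k j s = N j) :
    ∏ j, (N j).factorial ≤
      Nat.card {A : Assignment S N // ∀ i, A.total a i = ∑ j, ∑ s, k j s * a j s i} *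
        ∏ j, ∏ s, (k j s).factorial := by
  classical
  have h1 : ∏ j, Nat.card {f : Fin (N j) → S j // ∀ s, Nat.card {v // f v = s} = k j s} ≤
      Nat.card {A : Assignment S N // ∀ i, A.total a i = ∑ j, ∑ s, k j s * a j s i} := by
    rw [← Nat.card_pi]
    refine Nat.card_le_card_of_injective
      (fun F => ⟨fun v => (F v.1).1 v.2, fun i => ?_⟩) ?_
    · rw [Assignment.total_eq_sum_profile]
      exact Finset.sum_congr rfl fun j _ => Finset.sum_congr rfl fun s _ => by
        rw [← (F j).2 s]
    · intro F G h
      funext j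
      refine Subtype.ext (funext fun v => ?_)
      exact congrFun (congrArg Subtype.val h) ⟨j, v⟩
  refine le_trans ?_ (Nat.mul_le_mul_right _ h1)
  rw [← Finset.prod_mul_distrib]
  refine Finset.prod_le_prod' fun j _ => ?_
  simpa using factorial_card_le (α := Fin (N j)) (k j) (by simpa using hk j)

/-- The number of assignments with a given profile is, up to a polynomial factor, the exponential
of the entropy of the profile. -/
theorem le_log_card_total {ρ : J → ℝ} {n : ℕ} (hn : 0 < n) (hN : ∀ j, (N j : ℝ) = n * ρ j)
    (k : ∀ j, S j → ℕ) (hk : ∀ j, ∑ s, k j s = N j) :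
    0 < Nat.card {A : Assignment S N // ∀ i, A.total a i = ∑ j, ∑ s, k j s * a j s i} ∧
    n * profileEntropy ρ (fun j s => (k j s : ℝ) / n) - ∑ j, ∑ _s : S j, (1 + log (n * ρ j + 1)) ≤
      log (Nat.card {A : Assignment S N // ∀ i, A.total a i = ∑ j, ∑ s, k j s * a j s i}) := by
  have h := prod_factorial_le a k hk
  set M := Nat.card {A : Assignment S N // ∀ i, A.total a i = ∑ j, ∑ s, k j s * a j s i} with hM
  have hn' : (0 : ℝ) < n := by exact_mod_cast hn
  have hMpos : 0 < M := by
    rcases Nat.eq_zero_or_pos M with h0 | h0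
    · rw [h0, zero_mul] at h
      exact absurd h (not_le.2 (Finset.prod_pos fun j _ => Nat.factorial_pos _))
    · exact h0
  refine ⟨hMpos, ?_⟩
  have hM' : (0 : ℝ) < M := by exact_mod_cast hMpos
  have hf : ∀ q : ℕ, (q.factorial : ℝ) ≠ 0 := fun q => by exact_mod_cast q.factorial_ne_zero
  have h2 : (∏ j, ((N j).factorial : ℝ)) ≤ M * ∏ j, ∏ s, ((k j s).factorial : ℝ) := by
    exact_mod_cast h
  have h3 := log_le_log (Finset.prod_pos fun j _ => lt_of_le_of_ne (by positivity) (hf _).symm) h2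
  rw [log_mul hM'.ne' (Finset.prod_ne_zero_iff.2 fun j _ => Finset.prod_ne_zero_iff.2
    fun s _ => hf _), log_prod fun j _ => hf _, log_prod fun j _ => Finset.prod_ne_zero_iff.2
    fun s _ => hf _] at h3
  refine le_trans ?_ (sub_le_iff_le_add.2 h3)
  rw [profileEntropy, Finset.mul_sum, ← Finset.sum_sub_distrib, ← Finset.sum_sub_distrib]
  refine Finset.sum_le_sum fun j _ => ?_
  rw [log_prod fun s _ => hf _]
  have hup : ∀ s, log ((k j s).factorial : ℝ) ≤
      -(negMulLog (k j s)) - k j s + (1 + log (n * ρ j + 1)) := by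
    intro s
    have h4 : k j s ≤ N j := by
      rw [← hk j]; exact Finset.single_le_sum (fun _ _ => Nat.zero_le _) (mem_univ s)
    have h5 : (k j s : ℝ) ≤ n * ρ j := by rw [← hN]; exact_mod_cast h4
    have h6 : log ((k j s : ℝ) + 1) ≤ log (n * ρ j + 1) :=
      log_le_log (by positivity) (by linarith)
    linarith [log_factorial_le (k j s)]
  have hlow := le_log_factorial (N j)
  have hsum := Finset.sum_le_sum fun s (_ : s ∈ univ) => hup s
  have hkN : ∑ s, (k j s : ℝ) = N j := by exact_mod_cast hk j
  rw [Finset.sum_add_distrib, Finset.sum_sub_distrib, hkN, Finset.sum_neg_distrib] at hsum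
  have e1 : ∀ s, negMulLog (k j s : ℝ) =
      (k j s : ℝ) / n * negMulLog n + n * negMulLog ((k j s : ℝ) / n) := by
    intro s
    rw [← negMulLog_mul]; congr 1; field_simp
  have e2 : negMulLog (N j : ℝ) = ρ j * negMulLog n + n * negMulLog (ρ j) := by
    rw [← negMulLog_mul, hN]
  have e3 : ∑ s, negMulLog (k j s : ℝ) =
      ρ j * negMulLog n + n * ∑ s, negMulLog ((k j s : ℝ) / n) := by
    simp only [e1]
    rw [Finset.sum_add_distrib, ← Finset.sum_mul, ← Finset.sum_div, hkN, hN, Finset.mul_sum]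
    congr 2; field_simp
  rw [e3] at hsum
  rw [e2] at hlow
  linarith

end Assignments

/-! ### The ensemble average as a sum over assignments -/

/-- The binary labellings of the sockets of a check node of type `d` that have even sum. -/
abbrev LocalCodeword {m : ℕ} (d : Fin m → ℕ) : Type :=
  {y : (i : Fin m) → Fin (d i) → ZMod 2 // ∑ i, ∑ j, y i j = 0}

/-- The coordinates of exponent vectors: one for `t`, one for each `s i`, one for each `u i`. -/
abbrev Coord (m : ℕ) : Type := Unit ⊕ (Fin m ⊕ Fin m)

namespace DegreePair

variable {m : ℕ} (D : DegreePair m)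

/-- The types of variable nodes and of check nodes. -/
abbrev NodeType : Type := {τ // τ ∈ D.nu.support} ⊕ {d // d ∈ D.mu.support}

/-- A variable node is in the state `0` or `1`; the state of a check node is a labelling of its
sockets with even sum. -/
def NodeState : D.NodeType → Type
  | .inl _ => ZMod 2
  | .inr d => LocalCodeword d.1

instance : ∀ j, Fintype (D.NodeState j)
  | .inl _ => inferInstanceAs (Fintype (ZMod 2))
  | .inr d => inferInstanceAs (Fintype (LocalCodeword d.1))

instance : ∀ j, Nonempty (D.NodeState j)
  | .inl _ => inferInstanceAs (Nonempty (ZMod 2))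
  | .inr _ => ⟨⟨fun _ _ => 0, by simp⟩⟩

/-- The number of nodes of each type, divided by the code length. -/
def density : D.NodeType → ℝ
  | .inl τ => D.nu τ.1
  | .inr d => D.mu d.1

/-- The number of nodes of each type. -/
noncomputable def nodeCount (n : ℕ) (j : D.NodeType) : ℕ := ⌊(n : ℝ) * D.density j⌋₊

/-- The contribution of a node to the weight (coordinate `t`), to the number of variable sockets
labelled `1` (coordinates `s i`) and to the number of check sockets labelled `1`
(coordinates `u i`). -/
def exponent : ∀ j : D.NodeType, D.NodeState j → Coord m → ℕ
  | .inl τ, e, .inl _ => ZMod.val (n := 2) e * τ.1.1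
  | .inl τ, e, .inr (.inl i) => ZMod.val (n := 2) e * τ.1.2 i
  | .inl _, _, .inr (.inr _) => 0
  | .inr _, _, .inl _ => 0
  | .inr _, _, .inr (.inl _) => 0
  | .inr _, y, .inr (.inr i) => ∑ j, (y.1 i j).val

theorem density_pos (j : D.NodeType) : 0 < D.density j := by
  rcases j with τ | d
  · exact lt_of_le_of_ne (D.nu_nonneg _) (Ne.symm (Finsupp.mem_support_iff.1 τ.2))
  · exact lt_of_le_of_ne (D.mu_nonneg _) (Ne.symm (Finsupp.mem_support_iff.1 d.2))

variable {D} {n : ℕ}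

theorem Admissible.nodeCount_eq (hn : D.Admissible n) (j : D.NodeType) :
    (D.nodeCount n j : ℝ) = n * D.density j := by
  rcases j with τ | d
  · obtain ⟨k, hk⟩ := hn.2.1 τ.1
    simp only [nodeCount, density, hk, Nat.floor_natCast]
  · obtain ⟨k, hk⟩ := hn.2.2 d.1
    simp only [nodeCount, density, hk, Nat.floor_natCast]

theorem Admissible.card_checkSocket (hn : D.Admissible n) (i : Fin m) :
    (Fintype.card (D.CheckSocket n i) : ℝ) = n * D.muDeriv i := by
  rw [Fintype.card_sigma, Fintype.sum_sigma, muDeriv, Finset.mul_sum,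
    ← Finset.sum_coe_sort D.mu.support fun d => (n : ℝ) * ((d i : ℝ) * D.mu d), Nat.cast_sum]
  refine Finset.sum_congr rfl fun d _ => ?_
  have h := hn.nodeCount_eq (.inr d)
  simp only [nodeCount, density] at h
  simp only [Fintype.card_fin, Finset.sum_const, Finset.card_univ, smul_eq_mul, Nat.cast_mul, h]
  ring

theorem Admissible.card_varSocket (hn : D.Admissible n) (i : Fin m) :
    (Fintype.card (D.VarSocket n i) : ℝ) = n * D.muDeriv i := by
  rw [Fintype.card_sigma, Fintype.sum_sigma, muDeriv, ← D.edges_eq, Finset.mul_sum,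
    ← Finset.sum_coe_sort D.nu.support fun τ => (n : ℝ) * ((τ.2 i : ℝ) * D.nu τ), Nat.cast_sum]
  refine Finset.sum_congr rfl fun d _ => ?_
  have h := hn.nodeCount_eq (.inl d)
  simp only [nodeCount, density] at h
  simp only [Fintype.card_fin, Finset.sum_const, Finset.card_univ, smul_eq_mul, Nat.cast_mul, h]
  ring

theorem Admissible.card_socket_eq (hn : D.Admissible n) (i : Fin m) :
    Fintype.card (D.VarSocket n i) = Fintype.card (D.CheckSocket n i) := by
  have := (hn.card_varSocket i).trans (hn.card_checkSocket i).symm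
  exact_mod_cast this

variable (D n) in
/-- The assignments of labels to the variable nodes and of local codewords to the check nodes. -/
abbrev NodeAssignment : Type := Assignment D.NodeState (D.nodeCount n)

/-- The label of a variable node. -/
def varLabel (A : D.NodeAssignment n) (v : D.VarNode n) : ZMod 2 := A ⟨.inl v.1, v.2⟩

/-- The label of a socket of a variable node. -/
def varSocketLabel (A : D.NodeAssignment n) (i : Fin m) (σ : D.VarSocket n i) : ZMod 2 :=
  varLabel A σ.1

/-- The local codeword at a check node. -/
def checkState (A : D.NodeAssignment n) (c : D.CheckNode n) : LocalCodeword c.1.1 :=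
  A ⟨.inr c.1, c.2⟩

/-- The label of a socket of a check node. -/
def checkSocketLabel (A : D.NodeAssignment n) (i : Fin m) (σ : D.CheckSocket n i) : ZMod 2 :=
  (checkState A σ.1).1 i σ.2

theorem card_eq_one_eq_sum {α : Type*} [Fintype α] (f : α → ZMod 2) :
    Nat.card {v // f v = 1} = ∑ v, (f v).val := by
  classical
  rw [Nat.card_eq_fintype_card, Fintype.card_subtype, Finset.card_filter]
  refine Finset.sum_congr rfl fun v _ => ?_
  generalize f v = e
  revert e
  decide

theorem card_eq_zero_eq {α : Type*} [Fintype α] (f : α → ZMod 2) :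
    Nat.card {v // f v = 0} = Fintype.card α - Nat.card {v // f v = 1} := by
  classical
  have e : {v // f v = 0} ≃ {v // ¬ f v = 1} :=
    Equiv.subtypeEquivRight fun v => by
      generalize f v = b
      revert b; decide
  rw [Nat.card_congr e, Nat.card_eq_fintype_card, Nat.card_eq_fintype_card,
    Fintype.card_subtype_compl]

theorem total_t (A : D.NodeAssignment n) :
    A.total D.exponent (.inl ()) = weight (varLabel A) := by
  classical
  rw [Assignment.total, Fintype.sum_sigma, Fintype.sum_sum_type, weight, Finset.card_filter,
    Fintype.sum_sigma]
  refine (add_eq_left.2 (Finset.sum_eq_zero fun d _ => Finset.sum_eq_zero fun k _ => rfl)).trans ?_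
  refine Finset.sum_congr rfl fun τ _ => Finset.sum_congr rfl fun k _ => ?_
  change ZMod.val (varLabel A ⟨τ, k⟩) * (τ.1.1 : ℕ) =
    if τ.1.1 = 1 ∧ varLabel A ⟨τ, k⟩ = 1 then 1 else 0
  generalize varLabel A ⟨τ, k⟩ = e
  generalize τ.1.1 = b
  revert e b
  decide

theorem total_s (A : D.NodeAssignment n) (i : Fin m) :
    A.total D.exponent (.inr (.inl i)) = Nat.card {σ // varSocketLabel A i σ = 1} := by
  rw [card_eq_one_eq_sum, Assignment.total, Fintype.sum_sigma, Fintype.sum_sum_type,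
    Fintype.sum_sigma, Fintype.sum_sigma]
  refine (add_eq_left.2 (Finset.sum_eq_zero fun d _ => Finset.sum_eq_zero fun k _ => rfl)).trans ?_
  refine Finset.sum_congr rfl fun τ _ => Finset.sum_congr rfl fun k _ => ?_
  change ZMod.val (varLabel A ⟨τ, k⟩) * τ.1.2 i = ∑ _j : Fin (τ.1.2 i), ZMod.val (varLabel A ⟨τ, k⟩)
  simp [mul_comm]

theorem total_u (A : D.NodeAssignment n) (i : Fin m) :
    A.total D.exponent (.inr (.inr i)) = Nat.card {σ // checkSocketLabel A i σ = 1} := by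
  rw [card_eq_one_eq_sum, Assignment.total, Fintype.sum_sigma, Fintype.sum_sum_type,
    Fintype.sum_sigma, Fintype.sum_sigma]
  refine (add_eq_right.2 (Finset.sum_eq_zero fun d _ => Finset.sum_eq_zero fun k _ => rfl)).trans ?_
  rfl

/-- The number of ways to connect the sockets of one edge-type such that their labels agree. -/
theorem card_matching {α β : Type*} [Fintype α] [Fintype β] (f : α → ZMod 2) (g : β → ZMod 2)
    (h : Fintype.card α = Fintype.card β) :
    Nat.card {e : α ≃ β // g ∘ e = f} =
      if Nat.card {v // f v = 1} = Nat.card {w // g w = 1} then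
        (Nat.card {v // f v = 1}).factorial *
          (Fintype.card α - Nat.card {v // f v = 1}).factorial
      else 0 := by
  classical
  split_ifs with h1
  · rw [card_equiv_comp_eq f g]
    · change ∏ s : Fin 2, (Nat.card {v // f v = (s : ZMod 2)}).factorial = _
      rw [Fin.prod_univ_two]
      change (Nat.card {v // f v = 0}).factorial * (Nat.card {v // f v = 1}).factorial = _
      rw [card_eq_zero_eq f, mul_comm]
    · intro s
      have hs : s = 0 ∨ s = 1 := by revert s; decide
      rcases hs with rfl | rfl
      · rw [card_eq_zero_eq f, card_eq_zero_eq g, h1, h]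
      · exact h1
  · rw [Nat.card_eq_zero]
    left
    refine ⟨fun ⟨e, he⟩ => h1 (Nat.card_congr (e.subtypeEquiv fun v => ?_))⟩
    rw [← he]; rfl

/-- A codeword of a graph amounts to an assignment with equal labels at the two ends of each
edge. -/
theorem numCodewords_eq (G : D.Graph n) (ℓ : ℕ) :
    numCodewords G ℓ = Nat.card {A : D.NodeAssignment n //
      (∀ i, checkSocketLabel A i ∘ G i = varSocketLabel A i) ∧
        A.total D.exponent (.inl ()) = ℓ} := by
  refine Nat.card_congr
    { toFun := fun x => ⟨fun v => match v with
        | ⟨.inl τ, k⟩ => x.1 ⟨τ, k⟩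
        | ⟨.inr d, k⟩ =>
          (⟨fun i j => x.1 ((G i).symm ⟨⟨d, k⟩, j⟩).1, x.2.1 ⟨d, k⟩⟩ : LocalCodeword d.1), ?_, ?_⟩
      invFun := fun A => ⟨varLabel A.1, ?_, ?_⟩
      left_inv := fun x => rfl
      right_inv := fun A => ?_ }
  · intro i
    funext σ
    change x.1 ((G i).symm (G i σ)).1 = x.1 σ.1
    rw [Equiv.symm_apply_apply]
  · rw [total_t]
    exact x.2.2
  · intro c
    have h := (checkState A.1 c).2
    rw [← h]
    refine Finset.sum_congr rfl fun i _ => Finset.sum_congr rfl fun j _ => ?_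
    have h2 := congrFun (A.2.1 i) ((G i).symm ⟨c, j⟩)
    simp only [Function.comp, Equiv.apply_symm_apply] at h2
    exact h2.symm
  · rw [← total_t]
    exact A.2.2
  · refine Subtype.ext (funext fun v => ?_)
    rcases v with ⟨τ | d, k⟩
    · rfl
    · refine Subtype.ext (funext fun i => funext fun j => ?_)
      have h2 := congrFun (A.2.1 i) ((G i).symm ⟨⟨d, k⟩, j⟩)
      simp only [Function.comp, Equiv.apply_symm_apply] at h2
      exact h2.symm

theorem total_s_le (A : D.NodeAssignment n) (i : Fin m) :
    A.total D.exponent (.inr (.inl i)) ≤ Fintype.card (D.VarSocket n i) := by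
  rw [total_s, ← Nat.card_eq_fintype_card]
  exact Nat.card_le_card_of_injective _ Subtype.val_injective

theorem Admissible.card_graph (hn : D.Admissible n) :
    Fintype.card (D.Graph n) = ∏ i, (Fintype.card (D.VarSocket n i)).factorial := by
  classical
  rw [← Nat.card_eq_fintype_card, Nat.card_pi]
  refine Finset.prod_congr rfl fun i _ => ?_
  let e := Fintype.equivOfCardEq (hn.card_socket_eq i)
  rw [Nat.card_congr ((Equiv.refl _).equivCongr e.symm), Nat.card_perm, Nat.card_eq_fintype_card]

open Classical in
theorem Admissible.sum_numCodewords (hn : D.Admissible n) (ℓ : ℕ) :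
    ∑ G : D.Graph n, numCodewords G ℓ = ∑ A : D.NodeAssignment n,
      if A.total D.exponent (.inl ()) = ℓ ∧ ∀ i, A.total D.exponent (.inr (.inl i)) =
          A.total D.exponent (.inr (.inr i)) then
        ∏ i, ((A.total D.exponent (.inr (.inl i))).factorial *
          (Fintype.card (D.VarSocket n i) - A.total D.exponent (.inr (.inl i))).factorial)
      else 0 := by
  have h1 : ∀ G : D.Graph n, numCodewords G ℓ = ∑ A : D.NodeAssignment n,
      if (∀ i, checkSocketLabel A i ∘ G i = varSocketLabel A i) ∧
        A.total D.exponent (.inl ()) = ℓ then 1 else 0 := by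
    intro G
    rw [numCodewords_eq, Nat.card_eq_fintype_card, Fintype.card_subtype, Finset.card_filter]
  simp only [h1]
  rw [Finset.sum_comm]
  refine Finset.sum_congr rfl fun A _ => ?_
  have h2 : (∑ G : D.Graph n, if ∀ i, checkSocketLabel A i ∘ G i = varSocketLabel A i then 1 else 0)
      = ∏ i, Nat.card {e : D.VarSocket n i ≃ D.CheckSocket n i //
          checkSocketLabel A i ∘ e = varSocketLabel A i} := by
    rw [← Nat.card_pi, ← Finset.card_filter, ← Fintype.card_subtype, ← Nat.card_eq_fintype_card]
    exact Nat.card_congr (Equiv.subtypePiEquivPi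
      (p := fun i (e : D.VarSocket n i ≃ D.CheckSocket n i) =>
        checkSocketLabel A i ∘ e = varSocketLabel A i))
  by_cases ht : A.total D.exponent (.inl ()) = ℓ
  · simp only [ht, and_true, true_and]
    rw [h2]
    simp only [card_matching _ _ (hn.card_socket_eq _), ← total_s, ← total_u]
    split_ifs with h3
    · exact Finset.prod_congr rfl fun i _ => if_pos (h3 i)
    · push Not at h3
      obtain ⟨i, hi⟩ := h3
      exact Finset.prod_eq_zero (mem_univ i) (if_neg hi)
  · simp [ht]

variable (D n) in
/-- The number of assignments of weight `ℓ` with `e i` sockets of type `i` labelled `1` on each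
side, for all `i`. -/
noncomputable def coeff (ℓ : ℕ) (e : Fin m → ℕ) : ℕ :=
  Nat.card {A : D.NodeAssignment n //
    ∀ q, A.total D.exponent q = Sum.elim (fun _ => ℓ) (Sum.elim e e) q}

open Classical in
theorem coeff_eq_sum (ℓ : ℕ) (e : Fin m → ℕ) :
    (D.coeff n ℓ e : ℝ) = ∑ A : D.NodeAssignment n,
      if ∀ q, A.total D.exponent q = Sum.elim (fun _ => ℓ) (Sum.elim e e) q then 1 else 0 := by
  let : Fintype (D.NodeAssignment n) := inferInstance
  rw [coeff, Nat.card_eq_fintype_card, Fintype.card_subtype, Finset.card_filter]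
  push_cast
  rfl

open Classical in
/-- The average number of codewords as a sum over the numbers of sockets labelled `1`. -/
theorem Admissible.avgCodewords_eq (hn : D.Admissible n) (ℓ : ℕ) :
    D.avgCodewords n ℓ = ∑ e : ∀ i, Fin (Fintype.card (D.VarSocket n i) + 1),
      (D.coeff n ℓ fun i => e i : ℝ) *
        ∏ i, ((Fintype.card (D.VarSocket n i)).choose (e i) : ℝ)⁻¹ := by
  have h1 : ∀ e : ∀ i, Fin (Fintype.card (D.VarSocket n i) + 1),
      (D.coeff n ℓ fun i => e i : ℝ) = ∑ A : D.NodeAssignment n,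
        if ∀ q, A.total D.exponent q =
          Sum.elim (fun _ => ℓ) (Sum.elim (fun i => (e i : ℕ)) fun i => (e i : ℕ)) q then 1
        else 0 := by
    exact fun e => coeff_eq_sum ℓ fun i => e i
  simp only [h1, Finset.sum_mul]
  rw [Finset.sum_comm, avgCodewords, hn.card_graph, ← Nat.cast_sum, hn.sum_numCodewords]
  push_cast
  rw [Finset.sum_div]
  refine Finset.sum_congr rfl fun A _ => ?_
  let e₀ : ∀ i, Fin (Fintype.card (D.VarSocket n i) + 1) := fun i =>
    ⟨A.total D.exponent (.inr (.inl i)), Nat.lt_succ_of_le (total_s_le A i)⟩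
  rw [Finset.sum_eq_single e₀]
  · have hiff : (∀ q, A.total D.exponent q =
          Sum.elim (fun _ => ℓ) (Sum.elim (fun i => (e₀ i : ℕ)) fun i => (e₀ i : ℕ)) q) ↔
        A.total D.exponent (.inl ()) = ℓ ∧ ∀ i, A.total D.exponent (.inr (.inl i)) =
          A.total D.exponent (.inr (.inr i)) := by
      constructor
      · intro h
        exact ⟨h (.inl ()), fun i => (h (.inr (.inr i))).symm⟩
      · rintro ⟨h, h'⟩ (q | q | q)
        · exact h
        · rfl
        · exact (h' q).symm
    simp only [hiff]
    split_ifs with h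
    · rw [one_mul, ← Finset.prod_div_distrib]
      refine Finset.prod_congr rfl fun i _ => ?_
      have h2 := Nat.choose_mul_factorial_mul_factorial (total_s_le A i)
      have h3 : ((Fintype.card (D.VarSocket n i)).factorial : ℝ) ≠ 0 := by
        exact_mod_cast Nat.factorial_ne_zero _
      have h4 : ((Fintype.card (D.VarSocket n i)).choose
          (A.total D.exponent (.inr (.inl i))) : ℝ) ≠ 0 := by
        exact_mod_cast (Nat.choose_pos (total_s_le A i)).ne'
      change _ = ((Fintype.card (D.VarSocket n i)).choose
          (A.total D.exponent (.inr (.inl i))) : ℝ)⁻¹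
      rw [div_eq_iff h3, ← h2]
      push_cast
      field_simp
    · simp
  · intro e _ he
    rw [if_neg, zero_mul]
    intro h
    exact he (funext fun i => Fin.ext (h (.inr (.inl i))).symm)
  · simp

end DegreePair

namespace DegreePair

variable {m : ℕ} (D : DegreePair m)

/-! ### The generating functions as partition functions -/

/-- The exponent vectors of the node states, with real entries. -/
def realExponent (j : D.NodeType) (s : D.NodeState j) (q : Coord m) : ℝ := D.exponent j s q

/-- The values of the linear constraints: weight `ω` and edge fractions `β` on either side. -/
def target (ω : ℝ) (β : Fin m → ℝ) : Coord m → ℝ := Sum.elim (fun _ => ω) (Sum.elim β β)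

/-- The logarithms of `t, s, u` as one vector. -/
noncomputable def logCoord (t : ℝ) (s u : Fin m → ℝ) : Coord m → ℝ :=
  Sum.elim (fun _ => log t) (Sum.elim (fun i => log (s i)) fun i => log (u i))

theorem sum_localCodeword (d : Fin m → ℕ) (w : Fin m → ZMod 2 → ℝ) :
    ∑ y : LocalCodeword d, ∏ i, ∏ j, w i (y.1 i j) =
      ((∏ i, (w i 0 + w i 1) ^ d i) + ∏ i, (w i 0 - w i 1) ^ d i) / 2 := by
  classical
  have hall : ∀ w : Fin m → ZMod 2 → ℝ,
      ∑ y : ((i : Fin m) → Fin (d i) → ZMod 2), ∏ i, ∏ j, w i (y i j) =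
        ∏ i, (w i 0 + w i 1) ^ d i := by
    intro w
    rw [← Fintype.prod_sum fun i (z : Fin (d i) → ZMod 2) => ∏ j, w i (z j)]
    refine Finset.prod_congr rfl fun i _ => ?_
    rw [← Fintype.prod_sum fun (_ : Fin (d i)) (e : ZMod 2) => w i e, Finset.prod_const,
      Finset.card_univ, Fintype.card_fin]
    congr 1
    exact Fin.sum_univ_two (w i)
  -- the sign character of `ZMod 2` detects the labellings with even sum
  let χ : ZMod 2 → ℝ := fun e => if e = 0 then 1 else -1
  have hχadd : ∀ e f, χ (e + f) = χ e * χ f := by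
    intro e f
    have he : e = 0 ∨ e = 1 := by revert e; decide
    have hf : f = 0 ∨ f = 1 := by revert f; decide
    have h2 : (1 : ZMod 2) + 1 = 0 := by decide
    rcases he with rfl | rfl <;> rcases hf with rfl | rfl <;> simp [χ, h2]
  have hχsum : ∀ {α : Type} [Fintype α] (f : α → ZMod 2), χ (∑ a, f a) = ∏ a, χ (f a) := by
    intro α _ f
    induction (univ : Finset α) using Finset.induction_on with
    | empty => simp [χ]
    | insert a s ha ih => rw [Finset.sum_insert ha, Finset.prod_insert ha, hχadd, ih]
  have h1 := hall w
  have h2 := hall fun i e => χ e * w i e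
  have h3 : ∀ i, χ 0 * w i 0 + χ 1 * w i 1 = w i 0 - w i 1 := by
    intro i; simp [χ]; ring
  simp only [h3, Finset.prod_mul_distrib] at h2
  rw [← h1, ← h2, ← Finset.sum_add_distrib, Finset.sum_div,
    ← Finset.sum_subtype (univ.filter fun y : (i : Fin m) → Fin (d i) → ZMod 2 =>
      ∑ i, ∑ j, y i j = 0) (by simp) fun y => ∏ i, ∏ j, w i (y i j), Finset.sum_filter]
  refine Finset.sum_congr rfl fun y _ => ?_
  simp only [← hχsum]
  by_cases hy : ∑ i, ∑ j, y i j = 0 <;> simp [χ, hy]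

theorem partitionFn_inl (τ : {τ // τ ∈ D.nu.support}) (y : Coord m → ℝ) :
    partitionFn (D.realExponent (.inl τ)) y =
      1 + exp (y (.inl ())) ^ (τ.1.1 : ℕ) * ∏ i, exp (y (.inr (.inl i))) ^ τ.1.2 i := by
  have h : partitionFn (D.realExponent (.inl τ)) y =
      exp (energy (D.realExponent (.inl τ) (0 : ZMod 2)) y) +
        exp (energy (D.realExponent (.inl τ) (1 : ZMod 2)) y) :=
    Fin.sum_univ_two fun e : ZMod 2 => exp (energy (D.realExponent (.inl τ) e) y)
  rw [h]
  congr 1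
  · rw [exp_eq_one_iff]
    refine Finset.sum_eq_zero fun q _ => ?_
    rcases q with q | q | q <;> simp [realExponent, exponent]
  · simp only [← exp_nat_mul]
    rw [← exp_sum, ← exp_add]
    congr 1
    rw [energy, Fintype.sum_sum_type, Fintype.sum_sum_type]
    have : ZMod.val (1 : ZMod 2) = 1 := rfl
    simp [realExponent, exponent, this]

theorem partitionFn_inr (d : {d // d ∈ D.mu.support}) (y : Coord m → ℝ) :
    partitionFn (D.realExponent (.inr d)) y =
      ((∏ i, (1 + exp (y (.inr (.inr i)))) ^ d.1 i) +
        ∏ i, (1 - exp (y (.inr (.inr i)))) ^ d.1 i) / 2 := by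
  have h := sum_localCodeword d.1 fun i e => exp (e.val * y (.inr (.inr i)))
  have h0 : ZMod.val (0 : ZMod 2) = 0 := rfl
  have h1 : ZMod.val (1 : ZMod 2) = 1 := rfl
  simp only [h0, h1, Nat.cast_zero, zero_mul, exp_zero, Nat.cast_one, one_mul] at h
  rw [← h]
  refine Finset.sum_congr rfl fun z _ => ?_
  simp only [← exp_sum]
  congr 1
  rw [energy, Fintype.sum_sum_type, Fintype.sum_sum_type]
  simp only [realExponent, exponent]
  simp [Finset.sum_mul]

theorem log_Q_exp (y : Coord m → ℝ) :
    log (D.Q (exp (y (.inl ()))) fun i => exp (y (.inr (.inl i)))) =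
      ∑ τ : {τ // τ ∈ D.nu.support}, D.nu τ.1 * log (partitionFn (D.realExponent (.inl τ)) y) := by
  simp only [partitionFn_inl]
  rw [Q, log_prod fun τ _ => by positivity, ← Finset.sum_coe_sort D.nu.support]
  refine Finset.sum_congr rfl fun τ _ => ?_
  rw [log_rpow (by positivity)]

theorem log_P_exp (y : Coord m → ℝ) :
    log (D.P fun i => exp (y (.inr (.inr i)))) =
      ∑ d : {d // d ∈ D.mu.support}, D.mu d.1 * log (partitionFn (D.realExponent (.inr d)) y) := by
  have hpos : ∀ d : {d // d ∈ D.mu.support}, 0 < ((∏ i, (1 + exp (y (.inr (.inr i)))) ^ d.1 i) +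
        ∏ i, (1 - exp (y (.inr (.inr i)))) ^ d.1 i) / 2 := by
    intro d
    rw [← partitionFn_inr]
    exact partitionFn_pos (T := D.NodeState (.inr d)) _ _
  rw [P, log_prod fun d hd => (rpow_pos_of_pos (hpos ⟨d, hd⟩) _).ne',
    ← Finset.sum_coe_sort D.mu.support]
  refine Finset.sum_congr rfl fun d _ => ?_
  rw [log_rpow (hpos d), partitionFn_inr]

/-- The entropy term of `γ(β)`, which comes from the number of matchings of the sockets. -/
noncomputable def matchingEntropy (β : Fin m → ℝ) : ℝ :=
  ∑ i, D.muDeriv i * binEntropy (β i / D.muDeriv i)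

theorem objective_exp (ω : ℝ) (β : Fin m → ℝ) (y : Coord m → ℝ) :
    D.objective ω β (exp (y (.inl ()))) (fun i => exp (y (.inr (.inl i))))
        (fun i => exp (y (.inr (.inr i)))) =
      logPartition D.realExponent D.density y - ∑ q, target ω β q * y q -
        D.matchingEntropy β := by
  rw [objective, log_Q_exp, log_P_exp, logPartition, Fintype.sum_sum_type, Fintype.sum_sum_type,
    Fintype.sum_sum_type, matchingEntropy]
  simp only [log_exp, density, target, Sum.elim_inl, Sum.elim_inr, Finset.univ_unique,
    Finset.sum_singleton]
  ring

theorem objective_eq (ω : ℝ) (β : Fin m → ℝ) {t : ℝ} {s u : Fin m → ℝ} (ht : 0 < t)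
    (hs : ∀ i, 0 < s i) (hu : ∀ i, 0 < u i) :
    D.objective ω β t s u = logPartition D.realExponent D.density (logCoord t s u) -
      ∑ q, target ω β q * logCoord t s u q - D.matchingEntropy β := by
  rw [← objective_exp]
  simp only [logCoord, Sum.elim_inl, Sum.elim_inr, exp_log ht, exp_log (hs _), exp_log (hu _)]

theorem le_gammaBeta_iff {ω : ℝ} {β : Fin m → ℝ} {r : ℝ} :
    (r : EReal) ≤ D.gammaBeta ω β ↔ ∀ y : Coord m → ℝ,
      r ≤ logPartition D.realExponent D.density y - ∑ q, target ω β q * y q -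
        D.matchingEntropy β := by
  simp only [gammaBeta, le_iInf_iff, EReal.coe_le_coe_iff]
  constructor
  · intro h y
    rw [← objective_exp]
    exact h _ _ _ ⟨exp_pos _, fun _ => exp_pos _, fun _ => exp_pos _⟩
  · rintro h t s u ⟨ht, hs, hu⟩
    rw [objective_eq D ω β ht hs hu]
    exact h _

end DegreePair

/-! ### The growth rate -/

/-- The error of Stirling's formula for `n * c` nodes, divided by `n`. -/
noncomputable def stirlingError (c : ℝ) (n : ℕ) : ℝ := (1 + log (n * c + 1)) / n

theorem stirlingError_nonneg {c : ℝ} (hc : 0 < c) (n : ℕ) : 0 ≤ stirlingError c n := by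
  have : 0 ≤ log ((n : ℝ) * c + 1) := log_nonneg (by
    have : 0 ≤ (n : ℝ) * c := by positivity
    linarith)
  unfold stirlingError
  positivity

theorem tendsto_stirlingError {c : ℝ} (hc : 0 < c) :
    Tendsto (stirlingError c) atTop (𝓝 0) := by
  have h1 : Tendsto (fun n : ℕ => (n : ℝ) * c + 1) atTop atTop :=
    tendsto_atTop_add_const_right _ _ (tendsto_natCast_atTop_atTop.atTop_mul_const hc)
  have h2 := (tendsto_pow_log_div_mul_add_atTop c⁻¹ (-c⁻¹) 1 (inv_ne_zero hc.ne')).comp h1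
  have h3 : Tendsto (fun n : ℕ => (1 : ℝ) / n) atTop (𝓝 0) := tendsto_one_div_atTop_nhds_zero_nat
  have h4 := h3.add h2
  rw [add_zero] at h4
  refine h4.congr fun n => ?_
  have e : c⁻¹ * ((n : ℝ) * c + 1) + -c⁻¹ = n := by field_simp; ring
  simp only [Function.comp, pow_one, e, stirlingError]
  ring

namespace DegreePair

variable {m : ℕ} (D : DegreePair m)

/-- A bound for all subexponential factors of the average, on the exponential scale. -/
noncomputable def rateError (n : ℕ) : ℝ :=
  ∑ i, 3 * stirlingError (D.muDeriv i) n +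
    ∑ j, ∑ _s : D.NodeState j, stirlingError (D.density j) n

theorem muDeriv_pos (i : Fin m) : 0 < D.muDeriv i := D.edges_pos i

theorem tendsto_rateError : Tendsto D.rateError atTop (𝓝 0) := by
  have h := (tendsto_finsetSum (univ : Finset (Fin m)) fun i _ =>
    (tendsto_stirlingError (D.muDeriv_pos i)).const_mul 3).add
    (tendsto_finsetSum (univ : Finset D.NodeType) fun j _ =>
      tendsto_finsetSum (univ : Finset (D.NodeState j)) fun _ _ =>
        tendsto_stirlingError (D.density_pos j))
  simp only [mul_zero, Finset.sum_const_zero, add_zero] at h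
  exact h

variable {D} {n : ℕ}

theorem Admissible.abs_sum_log_choose_le (hn : D.Admissible n) (e : Fin m → ℕ)
    (he : ∀ i, e i ≤ Fintype.card (D.VarSocket n i)) :
    |(∑ i, log ((Fintype.card (D.VarSocket n i)).choose (e i) : ℝ)) -
        n * D.matchingEntropy (fun i => (e i : ℝ) / n)| ≤
      n * ∑ i, 2 * stirlingError (D.muDeriv i) n := by
  have hn' : (0 : ℝ) < n := by exact_mod_cast hn.1
  rw [matchingEntropy, Finset.mul_sum, Finset.mul_sum, ← Finset.sum_sub_distrib]
  refine (Finset.abs_sum_le_sum_abs _ _).trans (Finset.sum_le_sum fun i _ => ?_)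
  have hμ := D.muDeriv_pos i
  have hN := hn.card_varSocket i
  have hpos : 0 < Fintype.card (D.VarSocket n i) := by
    have : (0 : ℝ) < Fintype.card (D.VarSocket n i) := by rw [hN]; positivity
    exact_mod_cast this
  have h := abs_log_choose_sub_le (he i) hpos
  rw [hN] at h
  have e1 : (e i : ℝ) / n / D.muDeriv i = e i / (n * D.muDeriv i) := by field_simp
  have e2 : (n : ℝ) * (2 * stirlingError (D.muDeriv i) n) =
      2 * (1 + log (n * D.muDeriv i + 1)) := by
    rw [stirlingError]; field_simp
  rw [e1, e2, ← mul_assoc]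
  exact h

theorem Admissible.log_coeff_le (hn : D.Admissible n) {ω : ℝ} {ℓ : ℕ} (hℓ : ω * n = ℓ)
    (e : Fin m → ℕ) (hc : 0 < D.coeff n ℓ e) (y : Coord m → ℝ) :
    log (D.coeff n ℓ e) ≤ n * (logPartition D.realExponent D.density y -
      ∑ q, target ω (fun i => (e i : ℝ) / n) q * y q) := by
  have hn' : (0 : ℝ) < n := by exact_mod_cast hn.1
  have h := log_card_total_add_le D.exponent (N := D.nodeCount n)
    (Sum.elim (fun _ => ℓ) (Sum.elim e e)) y hc
  have e1 : ∑ q, ((Sum.elim (fun _ => ℓ) (Sum.elim e e) : Coord m → ℕ) q : ℝ) * y q =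
      n * ∑ q, target ω (fun i => (e i : ℝ) / n) q * y q := by
    rw [Finset.mul_sum]
    refine Finset.sum_congr rfl fun q _ => ?_
    rcases q with q | q | q
    · simp only [target, Sum.elim_inl]
      rw [← hℓ]; ring
    · simp only [target, Sum.elim_inl, Sum.elim_inr]
      field_simp
    · simp only [target, Sum.elim_inr]
      field_simp
  have e2 : ∑ j, (D.nodeCount n j : ℝ) * log (partitionFn (fun s q => (D.exponent j s q : ℝ)) y) =
      n * logPartition D.realExponent D.density y := by
    rw [logPartition, Finset.mul_sum]
    refine Finset.sum_congr rfl fun j _ => ?_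
    rw [hn.nodeCount_eq, mul_assoc]
    rfl
  rw [e1, e2] at h
  have h' : log (D.coeff n ℓ e) + n * ∑ q, target ω (fun i => (e i : ℝ) / n) q * y q ≤
      n * logPartition D.realExponent D.density y := h
  linarith

/-- The exponential rate of the average is at most `sup_β γ(β)`, up to the error term. -/
theorem Admissible.rate_sub_error_le (hn : D.Admissible n) {ω : ℝ} {ℓ : ℕ} (hℓ : ω * n = ℓ)
    (h0 : D.avgCodewords n ℓ ≠ 0) :
    ((1 / (n : ℝ) * log (D.avgCodewords n ℓ) - D.rateError n : ℝ) : EReal) ≤ D.supGamma ω := by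
  have hn' : (0 : ℝ) < n := by exact_mod_cast hn.1
  set F : (∀ i, Fin (Fintype.card (D.VarSocket n i) + 1)) → ℝ := fun e =>
    (D.coeff n ℓ fun i => e i : ℝ) *
        ∏ i, ((Fintype.card (D.VarSocket n i)).choose (e i) : ℝ)⁻¹ with hF
  have havg : D.avgCodewords n ℓ = ∑ e, F e := hn.avgCodewords_eq ℓ
  have hF0 : ∀ e, 0 ≤ F e := fun e => by rw [hF]; positivity
  obtain ⟨e, -, he⟩ := Finset.exists_max_image univ F univ_nonempty
  have hle : D.avgCodewords n ℓ ≤ (∏ i, (Fintype.card (D.VarSocket n i) + 1 : ℝ)) * F e := by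
    rw [havg]
    refine (Finset.sum_le_card_nsmul _ _ _ he).trans (le_of_eq ?_)
    simp
  have havgpos : 0 < D.avgCodewords n ℓ :=
    lt_of_le_of_ne (by rw [havg]; exact Finset.sum_nonneg fun e _ => hF0 e) h0.symm
  have hFe : 0 < F e := by
    refine lt_of_le_of_ne (hF0 e) fun h => ?_
    rw [← h, mul_zero] at hle
    exact absurd hle (not_le.2 havgpos)
  have hcne : D.coeff n ℓ (fun i => e i) ≠ 0 := by
    intro h
    simp [hF, h] at hFe
  have hcpos : 0 < D.coeff n ℓ (fun i => e i) := Nat.pos_of_ne_zero hcne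
  have hch : ∀ i, ((Fintype.card (D.VarSocket n i)).choose (e i) : ℝ) ≠ 0 := fun i => by
    exact_mod_cast (Nat.choose_pos (Nat.lt_succ_iff.1 (e i).2)).ne'
  have hlogF : log (F e) = log (D.coeff n ℓ fun i => e i) -
      ∑ i, log ((Fintype.card (D.VarSocket n i)).choose (e i) : ℝ) := by
    rw [hF, log_mul (by exact_mod_cast hcne)
      (Finset.prod_ne_zero_iff.2 fun i _ => inv_ne_zero (hch i)),
      log_prod fun i _ => inv_ne_zero (hch i)]
    simp only [log_inv, Finset.sum_neg_distrib]
    ring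
  have hlog := log_le_log havgpos hle
  rw [log_mul (Finset.prod_ne_zero_iff.2 fun i _ => by positivity) hFe.ne',
    log_prod fun i _ => by positivity, hlogF] at hlog
  have hcard : ∑ i, log ((Fintype.card (D.VarSocket n i) : ℝ) + 1) ≤
      n * ∑ i, stirlingError (D.muDeriv i) n := by
    rw [Finset.mul_sum]
    refine Finset.sum_le_sum fun i _ => ?_
    rw [hn.card_varSocket, stirlingError]
    have : (n : ℝ) * ((1 + log (n * D.muDeriv i + 1)) / n) = 1 + log (n * D.muDeriv i + 1) := by
      field_simp
    linarith
  have hchoose := (abs_le.1 (hn.abs_sum_log_choose_le (fun i => e i)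
    fun i => Nat.lt_succ_iff.1 (e i).2)).1
  refine le_trans ?_ (le_iSup₂_of_le (fun i => ((e i : ℕ) : ℝ) / n) (fun i => by positivity) le_rfl)
  rw [le_gammaBeta_iff]
  intro y
  have hcoeff := hn.log_coeff_le hℓ (fun i => e i) hcpos y
  have herr : ∑ i, 3 * stirlingError (D.muDeriv i) n ≤ D.rateError n := by
    rw [rateError]
    refine le_add_of_nonneg_right (Finset.sum_nonneg fun j _ => Finset.sum_nonneg fun _ _ =>
      stirlingError_nonneg (D.density_pos j) n)
  rw [← Finset.mul_sum] at hchoose herr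
  have hfin : log (D.avgCodewords n ℓ) ≤ n * (logPartition D.realExponent D.density y -
      ∑ q, target ω (fun i => ((e i : ℕ) : ℝ) / n) q * y q -
      D.matchingEntropy (fun i => ((e i : ℕ) : ℝ) / n) + D.rateError n) := by
    have := mul_le_mul_of_nonneg_left herr hn'.le
    linarith
  rw [sub_le_iff_le_add, one_div, inv_mul_le_iff₀ hn']
  exact hfin

theorem Admissible.coeff_mul_le (hn : D.Admissible n) (ℓ : ℕ) (e : Fin m → ℕ)
    (he : ∀ i, e i ≤ Fintype.card (D.VarSocket n i)) :
    (D.coeff n ℓ e : ℝ) * ∏ i, ((Fintype.card (D.VarSocket n i)).choose (e i) : ℝ)⁻¹ ≤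
      D.avgCodewords n ℓ := by
  rw [hn.avgCodewords_eq]
  let F : (∀ i, Fin (Fintype.card (D.VarSocket n i) + 1)) → ℝ := fun e =>
    (D.coeff n ℓ fun i => e i : ℝ) *
      ∏ i, ((Fintype.card (D.VarSocket n i)).choose (e i) : ℝ)⁻¹
  have hF : ∀ e ∈ univ, 0 ≤ F e := fun e _ =>
    mul_nonneg (Nat.cast_nonneg _) (Finset.prod_nonneg fun i _ => inv_nonneg.2 (Nat.cast_nonneg _))
  let e' : ∀ i, Fin (Fintype.card (D.VarSocket n i) + 1) := fun i =>
    ⟨e i, Nat.lt_succ_of_le (he i)⟩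
  have h : F e' ≤ ∑ e, F e := Finset.single_le_sum hF (mem_univ e')
  have he' : (fun i => (e' i : ℕ)) = e := rfl
  have hFe : F e' = (D.coeff n ℓ e : ℝ) *
      ∏ i, ((Fintype.card (D.VarSocket n i)).choose (e i) : ℝ)⁻¹ := by
    simp only [F, e']
  rwa [hFe] at h

/-- The average is at least the contribution of a single profile. -/
theorem Admissible.profile_le_rate (hn : D.Admissible n) {ℓ : ℕ}
    (k : ∀ j, D.NodeState j → ℕ) (hk : ∀ j, ∑ s, k j s = D.nodeCount n j)
    (ht : ∑ j, ∑ s, k j s * D.exponent j s (.inl ()) = ℓ)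
    (hsu : ∀ i, ∑ j, ∑ s, k j s * D.exponent j s (.inr (.inl i)) =
      ∑ j, ∑ s, k j s * D.exponent j s (.inr (.inr i))) :
    profileEntropy D.density (fun j s => (k j s : ℝ) / n) -
        D.matchingEntropy (fun i =>
          moment D.realExponent (fun j s => (k j s : ℝ) / n) (.inr (.inl i))) - D.rateError n ≤
      1 / (n : ℝ) * log (D.avgCodewords n ℓ) := by
  have hn' : (0 : ℝ) < n := by exact_mod_cast hn.1
  set e : Fin m → ℕ := fun i => ∑ j, ∑ s, k j s * D.exponent j s (.inr (.inl i)) with he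
  have hcoeff : D.coeff n ℓ e = Nat.card {A : D.NodeAssignment n //
      ∀ q, A.total D.exponent q = ∑ j, ∑ s, k j s * D.exponent j s q} := by
    have : (Sum.elim (fun _ => ℓ) (Sum.elim e e) : Coord m → ℕ) =
        fun q => ∑ j, ∑ s, k j s * D.exponent j s q := by
      funext q
      rcases q with q | q | q
      · exact ht.symm
      · rfl
      · exact hsu q
    rw [coeff, this]
  obtain ⟨hpos, hlow⟩ := le_log_card_total D.exponent hn.1 hn.nodeCount_eq k hk
  rw [← hcoeff] at hpos hlow
  have heN : ∀ i, e i ≤ Fintype.card (D.VarSocket n i) := by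
    intro i
    rw [coeff] at hpos
    obtain ⟨⟨A, hA⟩⟩ := (Nat.card_pos_iff.1 hpos).1
    have h1 := hA (.inr (.inl i))
    simp only [Sum.elim_inr, Sum.elim_inl] at h1
    rw [← h1]
    exact total_s_le A i
  have hch : ∀ i, (0 : ℝ) < ((Fintype.card (D.VarSocket n i)).choose (e i) : ℝ) := fun i => by
    exact_mod_cast Nat.choose_pos (heN i)
  have hle : (D.coeff n ℓ e : ℝ) * ∏ i, ((Fintype.card (D.VarSocket n i)).choose (e i) : ℝ)⁻¹ ≤
      D.avgCodewords n ℓ := hn.coeff_mul_le ℓ e heN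
  have hcpos : (0 : ℝ) < D.coeff n ℓ e := by exact_mod_cast hpos
  have hlog := log_le_log (mul_pos hcpos (Finset.prod_pos fun i _ => inv_pos.2 (hch i))) hle
  rw [log_mul hcpos.ne' (Finset.prod_ne_zero_iff.2 fun i _ => (inv_pos.2 (hch i)).ne'),
    log_prod fun i _ => (inv_pos.2 (hch i)).ne'] at hlog
  simp only [log_inv, Finset.sum_neg_distrib] at hlog
  have hchoose := (abs_le.1 (hn.abs_sum_log_choose_le e heN)).2
  have hmom : (fun i => moment D.realExponent (fun j s => (k j s : ℝ) / n) (.inr (.inl i))) =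
      fun i => (e i : ℝ) / n := by
    funext i
    simp only [moment, realExponent, he]
    push_cast
    rw [Finset.sum_div]
    refine Finset.sum_congr rfl fun j _ => ?_
    rw [Finset.sum_div]
    exact Finset.sum_congr rfl fun s _ => by ring
  have herr1 : ∑ j, ∑ _s : D.NodeState j, (1 + log (n * D.density j + 1)) =
      n * ∑ j, ∑ _s : D.NodeState j, stirlingError (D.density j) n := by
    simp only [Finset.mul_sum, stirlingError]
    refine Finset.sum_congr rfl fun j _ => Finset.sum_congr rfl fun s _ => ?_
    field_simp
  have herr2 : ∑ i, 2 * stirlingError (D.muDeriv i) n ≤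
      ∑ i, 3 * stirlingError (D.muDeriv i) n :=
    Finset.sum_le_sum fun i _ => by linarith [stirlingError_nonneg (D.muDeriv_pos i) n]
  rw [herr1] at hlow
  rw [hmom, one_div, le_inv_mul_iff₀ hn', rateError]
  have := mul_le_mul_of_nonneg_left herr2 hn'.le
  linarith

theorem continuous_matchingEntropy : Continuous D.matchingEntropy := by
  unfold matchingEntropy
  have := binEntropy_continuous
  fun_prop

theorem exists_assignment (hn : D.Admissible n) {ℓ : ℕ} (h0 : D.avgCodewords n ℓ ≠ 0) :
    ∃ A : D.NodeAssignment n, A.total D.exponent (.inl ()) = ℓ ∧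
      ∀ i, A.total D.exponent (.inr (.inl i)) = A.total D.exponent (.inr (.inr i)) := by
  rw [hn.avgCodewords_eq] at h0
  obtain ⟨e, -, he⟩ := Finset.exists_ne_zero_of_sum_ne_zero h0
  have hc : D.coeff n ℓ (fun i => e i) ≠ 0 := by
    intro h
    simp [h] at he
  rw [coeff] at hc
  obtain ⟨⟨A, hA⟩⟩ := (Nat.card_ne_zero.1 hc).1
  exact ⟨A, hA (.inl ()), fun i => (hA (.inr (.inl i))).trans (hA (.inr (.inr i))).symm⟩

/-- The linear constraints on the profiles: the number of nodes of each type, the weight, and the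
equality of the numbers of sockets labelled `1` on the two sides. -/
def constraintMatrix (D : DegreePair m) [DecidableEq D.NodeType] :
    D.NodeType ⊕ (Unit ⊕ Fin m) → (Σ j, D.NodeState j) → ℤ :=
  Sum.elim (fun j x => if x.1 = j then 1 else 0)
    (Sum.elim (fun _ x => D.exponent x.1 x.2 (.inl ()))
      fun i x => (D.exponent x.1 x.2 (.inr (.inl i)) : ℤ) - D.exponent x.1 x.2 (.inr (.inr i)))

theorem sum_constraintMatrix_inl [DecidableEq D.NodeType] (j : D.NodeType)
    (z : (Σ j, D.NodeState j) → ℝ) :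
    ∑ x, (D.constraintMatrix (.inl j) x : ℝ) * z x = ∑ s, z ⟨j, s⟩ := by
  rw [Fintype.sum_sigma, Finset.sum_eq_single j]
  · simp [constraintMatrix]
  · intro j' _ hj
    simp [constraintMatrix, hj]
  · simp

theorem sum_constraintMatrix_t [DecidableEq D.NodeType] (z : (Σ j, D.NodeState j) → ℝ) :
    ∑ x, (D.constraintMatrix (.inr (.inl ())) x : ℝ) * z x =
      ∑ j, ∑ s, z ⟨j, s⟩ * D.exponent j s (.inl ()) := by
  rw [Fintype.sum_sigma]
  refine Finset.sum_congr rfl fun j _ => Finset.sum_congr rfl fun s _ => ?_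
  simp [constraintMatrix, mul_comm]

theorem sum_constraintMatrix_su [DecidableEq D.NodeType] (i : Fin m)
    (z : (Σ j, D.NodeState j) → ℝ) :
    ∑ x, (D.constraintMatrix (.inr (.inr i)) x : ℝ) * z x =
      (∑ j, ∑ s, z ⟨j, s⟩ * D.exponent j s (.inr (.inl i))) -
        ∑ j, ∑ s, z ⟨j, s⟩ * D.exponent j s (.inr (.inr i)) := by
  rw [Fintype.sum_sigma, ← Finset.sum_sub_distrib]
  refine Finset.sum_congr rfl fun j _ => ?_
  rw [← Finset.sum_sub_distrib]
  refine Finset.sum_congr rfl fun s _ => ?_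
  simp only [constraintMatrix, Sum.elim_inr]
  push_cast
  ring

/-- The exponential rate of the average is eventually above each number below `sup_β γ(β)`. -/
theorem eventually_lt_rate (ω : ℝ) {a : EReal} (ha : a < D.supGamma ω) :
    ∀ᶠ n : ℕ in D.lengths ω,
      a < ((1 / (n : ℝ) * log (D.avgCodewords n ⌊ω * n⌋₊) : ℝ) : EReal) := by
  classical
  obtain ⟨r, har, hr⟩ := EReal.lt_iff_exists_real_btwn.1 ha
  obtain ⟨r', hrr', hr'⟩ := EReal.lt_iff_exists_real_btwn.1 hr
  have hrr : r < r' := EReal.coe_lt_coe_iff.1 hrr'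
  simp only [supGamma, lt_iSup_iff] at hr'
  obtain ⟨β, -, hγ⟩ := hr'
  rw [supGamma] at hr
  -- a profile realising `γ(β)`
  obtain ⟨p, hp, hent, hmom⟩ := exists_profile_entropy_ge D.realExponent D.density_pos
    (c := target ω β) (r := r' + D.matchingEntropy β) (fun y => by
      have := D.le_gammaBeta_iff.1 hγ.le y
      linarith)
  let Φ : (∀ j, D.NodeState j → ℝ) → ℝ := fun q => profileEntropy D.density q -
    D.matchingEntropy fun i => moment D.realExponent q (.inr (.inl i))
  have hΦ : Continuous Φ :=
    continuous_profileEntropy.sub (continuous_matchingEntropy.comp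
      (continuous_pi fun i => continuous_moment _ _))
  have hΦp : r' ≤ Φ p := by
    have : (fun i => moment D.realExponent p (.inr (.inl i))) = β := by
      funext i
      exact hmom (.inr (.inl i))
    simp only [Φ, this]
    linarith
  obtain ⟨δ, hδ, hball⟩ := Metric.isOpen_iff.1 (isOpen_lt continuous_const hΦ)
    p (show (r + r') / 2 < Φ p by linarith)
  obtain ⟨n₀, hn₀⟩ := exists_nat_point_near D.constraintMatrix
    (Sum.elim D.density (Sum.elim (fun _ => ω) fun _ => 0)) (z := fun x => p x.1 x.2)
    (fun x => hp.1 _ _) (by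
      rintro (j | q | i)
      · rw [sum_constraintMatrix_inl]
        exact hp.2 j
      · rw [sum_constraintMatrix_t]
        exact hmom (.inl ())
      · rw [sum_constraintMatrix_su]
        have h1 := hmom (.inr (.inl i))
        have h2 := hmom (.inr (.inr i))
        simp only [moment, realExponent, target, Sum.elim_inr, Sum.elim_inl] at h1 h2
        simp only [h1, h2, sub_self, Sum.elim_inr]) (half_pos hδ)
  have hev : ∀ᶠ n : ℕ in atTop, n₀ ≤ n ∧ D.rateError n < (r' - r) / 2 :=
    (eventually_ge_atTop n₀).and (D.tendsto_rateError.eventually_lt_const (by linarith))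
  rw [lengths, eventually_inf_principal]
  filter_upwards [hev] with n ⟨hn1, hn2⟩ ⟨hn, ⟨ℓ, hℓ⟩, h0⟩
  have hfl : ⌊ω * n⌋₊ = ℓ := by rw [hℓ, Nat.floor_natCast]
  rw [hfl] at h0 ⊢
  have hn' : (0 : ℝ) < n := by exact_mod_cast hn.1
  obtain ⟨A, hAt, hAsu⟩ := exists_assignment hn h0
  let k₀ : (Σ j, D.NodeState j) → ℕ := fun x =>
    Nat.card {v : Fin (D.nodeCount n x.1) // A ⟨x.1, v⟩ = x.2}
  obtain ⟨k, hkL, hkz⟩ := hn₀ n hn1 hn.1 k₀ (by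
    rintro (j | q | i)
    · rw [sum_constraintMatrix_inl]
      have h1 := Assignment.sum_profile A j
      simp only [Sum.elim_inl, k₀]
      rw [← hn.nodeCount_eq]
      exact_mod_cast h1
    · rw [sum_constraintMatrix_t]
      have h1 := Assignment.total_eq_sum_profile D.exponent A (.inl ())
      rw [hAt] at h1
      simp only [Sum.elim_inl, Sum.elim_inr, k₀]
      rw [mul_comm, hℓ]
      exact_mod_cast h1.symm
    · rw [sum_constraintMatrix_su]
      have h1 := Assignment.total_eq_sum_profile D.exponent A (.inr (.inl i))
      rw [hAsu i, Assignment.total_eq_sum_profile D.exponent A (.inr (.inr i))] at h1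
      simp only [Sum.elim_inr, mul_zero, k₀]
      rw [sub_eq_zero]
      exact_mod_cast h1.symm)
  have hrate := hn.profile_le_rate (ℓ := ℓ) (fun j s => k ⟨j, s⟩)
    (fun j => by
      have h1 := hkL (.inl j)
      rw [sum_constraintMatrix_inl] at h1
      simp only [Sum.elim_inl] at h1
      rw [← hn.nodeCount_eq] at h1
      exact_mod_cast h1)
    (by
      have h1 := hkL (.inr (.inl ()))
      rw [sum_constraintMatrix_t] at h1
      simp only [Sum.elim_inr, Sum.elim_inl] at h1
      rw [mul_comm (n : ℝ), hℓ] at h1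
      exact_mod_cast h1)
    (fun i => by
      have h1 := hkL (.inr (.inr i))
      rw [sum_constraintMatrix_su] at h1
      simp only [Sum.elim_inr, mul_zero] at h1
      rw [sub_eq_zero] at h1
      exact_mod_cast h1)
  have hclose : (r + r') / 2 < Φ fun j s => (k ⟨j, s⟩ : ℝ) / n := by
    refine hball ?_
    rw [Metric.mem_ball]
    refine lt_of_le_of_lt ?_ (half_lt_self hδ)
    refine (dist_pi_le_iff (half_pos hδ).le).2 fun j =>
      (dist_pi_le_iff (half_pos hδ).le).2 fun s => ?_
    exact hkz ⟨j, s⟩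
  refine har.trans (EReal.coe_lt_coe_iff.2 (lt_of_lt_of_le ?_ hrate))
  simp only [Φ] at hclose
  linarith

theorem tendsto_rate (D : DegreePair m) (ω : ℝ) :
    Tendsto (fun n : ℕ => ((1 / (n : ℝ) * log (D.avgCodewords n ⌊ω * n⌋₊) : ℝ) : EReal))
      (D.lengths ω) (𝓝 (D.supGamma ω)) := by
  refine tendsto_order.2 ⟨fun a ha => eventually_lt_rate ω ha, fun a ha => ?_⟩
  obtain ⟨r, hr, hra⟩ := EReal.lt_iff_exists_real_btwn.1 ha
  obtain ⟨r', hr', hrr'⟩ := EReal.lt_iff_exists_real_btwn.1 hr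
  have hrr : r' < r := EReal.coe_lt_coe_iff.1 hrr'
  rw [lengths, eventually_inf_principal]
  filter_upwards [D.tendsto_rateError.eventually_lt_const (show 0 < r - r' by linarith)]
    with n hn1 ⟨hn, ⟨ℓ, hℓ⟩, h0⟩
  have hfl : ⌊ω * n⌋₊ = ℓ := by rw [hℓ, Nat.floor_natCast]
  rw [hfl] at h0 ⊢
  have h1 := (hn.rate_sub_error_le hℓ h0).trans hr'.le
  rw [EReal.coe_le_coe_iff] at h1
  exact lt_of_le_of_lt (EReal.coe_le_coe_iff.2 (by linarith)) hra

end DegreePair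

/-! ### Stationary points -/

section Duality

variable {J : Type*} [Fintype J] {S : J → Type*} [∀ j, Fintype (S j)]
  {ι : Type*} [Fintype ι] (a : ∀ j, S j → ι → ℝ) {ρ : J → ℝ}

/-- At a minimiser of the dual problem, the Gibbs profile satisfies the moment constraints. -/
theorem moment_gibbs_eq [∀ j, Nonempty (S j)] {c y : ι → ℝ}
    (hy : ∀ z, logPartition a ρ y - ∑ i, c i * y i ≤ logPartition a ρ z - ∑ i, c i * z i) (i : ι) :
    moment a (gibbs a ρ y) i = c i := by
  classical
  have hmin : IsLocalMin (fun x : ℝ => logPartition a ρ (y + x • Pi.single i 1) -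
      ∑ k, c k * (y + x • Pi.single i 1 : ι → ℝ) k) 0 := by
    refine Filter.Eventually.of_forall fun x => ?_
    simpa only [zero_smul, add_zero] using hy (y + x • Pi.single i 1)
  have h0 := hmin.hasDerivAt_eq_zero (hasDerivAt_dual a c y i)
  linarith

theorem moment_add_smul (p η : ∀ j, S j → ℝ) (x : ℝ) (i : ι) :
    moment a (p + x • η) i = moment a p i + x * moment a η i := by
  simp only [moment, Pi.add_apply, Pi.smul_apply, smul_eq_mul, add_mul, Finset.sum_add_distrib,
    Finset.mul_sum, mul_assoc]

/-- The derivative of the entropy at a Gibbs profile, in a direction preserving the number of nodes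
of each type. -/
theorem hasDerivAt_profileEntropy [∀ j, Nonempty (S j)] (hρ : ∀ j, 0 < ρ j) (y : ι → ℝ)
    (η : ∀ j, S j → ℝ) (hη : ∀ j, ∑ s, η j s = 0) :
    HasDerivAt (fun x : ℝ => profileEntropy ρ (gibbs a ρ y + x • η))
      (-∑ i, moment a η i * y i) 0 := by
  rw [moment_mul_eq, ← Finset.sum_neg_distrib]
  unfold profileEntropy
  refine HasDerivAt.fun_sum fun j _ => ?_
  have h1 : ∀ s, HasDerivAt (fun x : ℝ => negMulLog ((gibbs a ρ y + x • η) j s))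
      ((-log (gibbs a ρ y j s) - 1) * η j s) 0 := by
    intro s
    have h2 : HasDerivAt (fun x : ℝ => (gibbs a ρ y + x • η) j s) (η j s) 0 := by
      simpa using ((hasDerivAt_id (0 : ℝ)).mul_const (η j s)).const_add (gibbs a ρ y j s)
    have h3 := hasDerivAt_negMulLog (gibbs_pos a hρ y j s).ne'
    refine HasDerivAt.comp (0 : ℝ) (h₂ := negMulLog) ?_ h2
    simpa using h3
  refine ((HasDerivAt.fun_sum fun s _ => h1 s).sub_const _).congr_deriv ?_
  have h4 : ∀ s, (-log (gibbs a ρ y j s) - 1) * η j s =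
      (log (partitionFn (a j) y) - log (ρ j) - 1) * η j s - η j s * energy (a j s) y := by
    intro s
    rw [log_gibbs a hρ]; ring
  simp only [h4]
  rw [Finset.sum_sub_distrib, ← Finset.mul_sum, hη, mul_zero, zero_sub]

end Duality

namespace DegreePair

variable {m : ℕ} {D : DegreePair m}

theorem exists_exponent_eq_zero (j : D.NodeType) : ∃ s, ∀ q, D.exponent j s q = 0 := by
  rcases j with τ | d
  · exact ⟨(0 : ZMod 2), by rintro (q | q | q) <;> simp [exponent]⟩
  · exact ⟨(⟨fun _ _ => 0, by simp⟩ : LocalCodeword d.1), by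
      rintro (q | q | q) <;> simp [exponent]⟩

theorem sum_exponent_s_state (p : ∀ j, D.NodeState j → ℝ) (i : Fin m) :
    moment D.realExponent p (.inr (.inl i)) =
      ∑ τ : {τ // τ ∈ D.nu.support}, p (.inl τ) (1 : ZMod 2) * τ.1.2 i := by
  rw [moment, Fintype.sum_sum_type]
  have h0 : ∑ d : {d // d ∈ D.mu.support}, ∑ s,
      p (.inr d) s * D.realExponent (.inr d) s (.inr (.inl i)) = 0 :=
    Finset.sum_eq_zero fun d _ => Finset.sum_eq_zero fun s _ => by simp [realExponent, exponent]
  rw [h0, add_zero]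
  refine Finset.sum_congr rfl fun τ _ => ?_
  have h2 : ∑ s, p (.inl τ) s * D.realExponent (.inl τ) s (.inr (.inl i)) =
      p (.inl τ) (0 : ZMod 2) * D.realExponent (.inl τ) (0 : ZMod 2) (.inr (.inl i)) +
        p (.inl τ) (1 : ZMod 2) * D.realExponent (.inl τ) (1 : ZMod 2) (.inr (.inl i)) :=
    Fin.sum_univ_two fun e : ZMod 2 => p (.inl τ) e * D.realExponent (.inl τ) e (.inr (.inl i))
  have h1 : ZMod.val (1 : ZMod 2) = 1 := rfl
  rw [h2]
  simp [realExponent, exponent, h1]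

theorem exists_nu_exponent_pos (D : DegreePair m) (i : Fin m) :
    ∃ τ : {τ // τ ∈ D.nu.support}, 0 < τ.1.2 i := by
  have h := D.edges_pos i
  rw [← D.edges_eq] at h
  obtain ⟨τ, hτ, hpos⟩ := Finset.exists_ne_zero_of_sum_ne_zero h.ne'
  refine ⟨⟨τ, hτ⟩, Nat.pos_of_ne_zero fun h0 => hpos ?_⟩
  simp only at h0
  simp [h0]

/-- The edge fractions of a Gibbs profile lie strictly between the trivial bounds. -/
theorem moment_gibbs_s_mem (y : Coord m → ℝ) (i : Fin m) :
    0 < moment D.realExponent (gibbs D.realExponent D.density y) (.inr (.inl i)) ∧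
      moment D.realExponent (gibbs D.realExponent D.density y) (.inr (.inl i)) < D.muDeriv i := by
  obtain ⟨τ₀, hτ₀⟩ := D.exists_nu_exponent_pos i
  have hτ₀' : (0 : ℝ) < τ₀.1.2 i := by exact_mod_cast hτ₀
  have hg := gibbs_pos D.realExponent D.density_pos y
  rw [sum_exponent_s_state]
  constructor
  · exact Finset.sum_pos' (fun τ _ => mul_nonneg (hg _ _).le (Nat.cast_nonneg _))
      ⟨τ₀, mem_univ _, mul_pos (hg _ _) hτ₀'⟩
  · have hlt : ∀ τ, gibbs D.realExponent D.density y (.inl τ) (1 : ZMod 2) < D.nu τ.1 := by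
      intro τ
      have h1 := (gibbs_mem D.realExponent D.density_pos y).2 (.inl τ)
      have h2 : gibbs D.realExponent D.density y (.inl τ) (0 : ZMod 2) +
          gibbs D.realExponent D.density y (.inl τ) (1 : ZMod 2) = D.nu τ.1 :=
        (Fin.sum_univ_two fun e : ZMod 2 =>
          gibbs D.realExponent D.density y (.inl τ) e).symm.trans h1
      have h3 := hg (.inl τ) (0 : ZMod 2)
      linarith
    rw [muDeriv, ← D.edges_eq, ← Finset.sum_coe_sort D.nu.support]
    refine Finset.sum_lt_sum (fun τ _ => ?_) ⟨τ₀, mem_univ _, ?_⟩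
    · rw [mul_comm]
      exact mul_le_mul_of_nonneg_left (hlt τ).le (Nat.cast_nonneg _)
    · rw [mul_comm]
      exact mul_lt_mul_of_pos_left (hlt τ₀) hτ₀'

theorem hasDerivAt_matchingEntropy {β : Fin m → ℝ} (hβ : ∀ i, 0 < β i ∧ β i < D.muDeriv i)
    (δ : Fin m → ℝ) :
    HasDerivAt (fun x : ℝ => D.matchingEntropy (β + x • δ))
      (-∑ i, δ i * log (β i / (D.muDeriv i - β i))) 0 := by
  rw [← Finset.sum_neg_distrib]
  unfold matchingEntropy
  refine HasDerivAt.fun_sum fun i _ => ?_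
  have hμ := D.muDeriv_pos i
  obtain ⟨h0, h1⟩ := hβ i
  have h2 : HasDerivAt (fun x : ℝ => (β + x • δ) i / D.muDeriv i) (δ i / D.muDeriv i) 0 := by
    simpa using (((hasDerivAt_id (0 : ℝ)).mul_const (δ i)).const_add (β i)).div_const (D.muDeriv i)
  have hne0 : β i / D.muDeriv i ≠ 0 := by positivity
  have hne1 : β i / D.muDeriv i ≠ 1 := by
    rw [Ne, div_eq_one_iff_eq hμ.ne']; exact h1.ne
  have h3 := hasDerivAt_binEntropy hne0 hne1
  have h4 := (HasDerivAt.comp (0 : ℝ) (h₂ := binEntropy) (by simpa using h3) h2).const_mul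
    (D.muDeriv i)
  refine h4.congr_deriv ?_
  have e1 : 1 - β i / D.muDeriv i = (D.muDeriv i - β i) / D.muDeriv i := by field_simp
  rw [e1, log_div (sub_pos.2 h1).ne' hμ.ne', log_div h0.ne' hμ.ne',
    log_div h0.ne' (sub_pos.2 h1).ne']
  field_simp
  ring

theorem profileEntropy_sub_le_supGamma {p : ∀ j, D.NodeState j → ℝ}
    (hp : p ∈ profiles D.NodeState D.density) {ω : ℝ} {β : Fin m → ℝ} (hβ : ∀ i, 0 ≤ β i)
    (hm : ∀ q, moment D.realExponent p q = target ω β q) :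
    ((profileEntropy D.density p - D.matchingEntropy β : ℝ) : EReal) ≤ D.supGamma ω := by
  refine le_trans ?_ (le_iSup₂_of_le β hβ le_rfl)
  rw [le_gammaBeta_iff]
  intro y
  have h := profileEntropy_add_moment_le D.realExponent D.density_pos hp y
  simp only [hm] at h
  linarith

/-- If `β` attains the supremum and `y` the infimum `γ(β)`, then the Gibbs profile at `y` maximises
the profile entropy minus the entropy of the matchings, so the first variation of this difference
vanishes in all admissible directions. -/
theorem first_variation_eq_zero {ω : ℝ} {β : Fin m → ℝ} {y : Coord m → ℝ}
    (hsup : D.supGamma ω = ((logPartition D.realExponent D.density y -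
      ∑ q, target ω β q * y q - D.matchingEntropy β : ℝ) : EReal))
    (hm : ∀ q, moment D.realExponent (gibbs D.realExponent D.density y) q = target ω β q)
    (η : ∀ j, D.NodeState j → ℝ) (hη : ∀ j, ∑ s, η j s = 0)
    (hηt : moment D.realExponent η (.inl ()) = 0)
    (hηsu : ∀ i, moment D.realExponent η (.inr (.inl i)) =
      moment D.realExponent η (.inr (.inr i))) :
    ∑ i, (log (β i / (D.muDeriv i - β i)) - y (.inr (.inl i)) - y (.inr (.inr i))) *
      moment D.realExponent η (.inr (.inl i)) = 0 := by
  set g := gibbs D.realExponent D.density y with hg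
  set δ : Fin m → ℝ := fun i => moment D.realExponent η (.inr (.inl i)) with hδ
  have hβ : ∀ i, 0 < β i ∧ β i < D.muDeriv i := by
    intro i
    have h := moment_gibbs_s_mem (D := D) y i
    rw [← hg, hm] at h
    exact h
  have hd := (hasDerivAt_profileEntropy D.realExponent D.density_pos y η hη).sub
    (hasDerivAt_matchingEntropy hβ δ)
  have hval : logPartition D.realExponent D.density y - ∑ q, target ω β q * y q =
      profileEntropy D.density g := by
    have h := profileEntropy_gibbs D.realExponent D.density_pos y
    rw [← hg] at h
    simp only [hm] at h
    linarith
  rw [hval] at hsup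
  have hmax : IsLocalMax (fun x : ℝ => profileEntropy D.density (g + x • η) -
      D.matchingEntropy (β + x • δ)) 0 := by
    have hpos : ∀ᶠ x : ℝ in 𝓝 0, ∀ j s, 0 < (g + x • η) j s := by
      refine eventually_all.2 fun j => eventually_all.2 fun s => ?_
      have hc : Continuous fun x : ℝ => (g + x • η) j s := by
        simp only [Pi.add_apply, Pi.smul_apply, smul_eq_mul]; fun_prop
      refine hc.continuousAt.eventually_const_lt ?_
      simpa using gibbs_pos D.realExponent D.density_pos y j s
    have hposβ : ∀ᶠ x : ℝ in 𝓝 0, ∀ i, 0 < (β + x • δ) i := by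
      refine eventually_all.2 fun i => ?_
      have hc : Continuous fun x : ℝ => (β + x • δ) i := by
        simp only [Pi.add_apply, Pi.smul_apply, smul_eq_mul]; fun_prop
      refine hc.continuousAt.eventually_const_lt ?_
      simpa using (hβ i).1
    filter_upwards [hpos, hposβ] with x hx hxβ
    have h := profileEntropy_sub_le_supGamma (D := D) (p := g + x • η) (ω := ω) (β := β + x • δ)
      ⟨fun j s => (hx j s).le, fun j => by
        simp only [Pi.add_apply, Pi.smul_apply, smul_eq_mul]
        rw [Finset.sum_add_distrib, ← Finset.mul_sum, hη, mul_zero, add_zero]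
        exact (gibbs_mem D.realExponent D.density_pos y).2 j⟩
      (fun i => (hxβ i).le) (by
        intro q
        rw [moment_add_smul, hm]
        rcases q with q | i | i
        · rw [hηt]; simp [target]
        · simp [target, hδ]
        · rw [← hηsu]; simp [target, hδ])
    rw [hsup, EReal.coe_le_coe_iff] at h
    simpa using h
  have h0 := hmax.hasDerivAt_eq_zero hd
  rw [Fintype.sum_sum_type, Fintype.sum_sum_type] at h0
  simp only [Finset.univ_unique, Finset.sum_singleton, ← hηsu] at h0
  have hηt' : moment D.realExponent η (.inl default) = 0 := hηt
  rw [hηt', zero_mul, zero_add] at h0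
  have e : ∀ i, (log (β i / (D.muDeriv i - β i)) - y (.inr (.inl i)) - y (.inr (.inr i))) * δ i =
      δ i * log (β i / (D.muDeriv i - β i)) -
        (δ i * y (.inr (.inl i)) + δ i * y (.inr (.inr i))) := fun i => by ring
  change ∑ i, _ * δ i = 0
  simp only [e]
  rw [Finset.sum_sub_distrib, Finset.sum_add_distrib]
  linarith

/-- By linear algebra, a functional of the edge fractions that vanishes in all admissible directions
comes from a vector `v` along which all energies are constant. Translating a minimiser of the dual
problem by `v` keeps it a minimiser and changes `log (s i * u i)` by `r i`. -/
theorem exists_flat_direction (r : Fin m → ℝ)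
    (h : ∀ η : ∀ j, D.NodeState j → ℝ, (∀ j, ∑ s, η j s = 0) →
      moment D.realExponent η (.inl ()) = 0 →
      (∀ i, moment D.realExponent η (.inr (.inl i)) = moment D.realExponent η (.inr (.inr i))) →
      ∑ i, r i * moment D.realExponent η (.inr (.inl i)) = 0) :
    ∃ v : Coord m → ℝ, (∀ j s, energy (D.realExponent j s) v = 0) ∧
      ∀ i, v (.inr (.inl i)) + v (.inr (.inr i)) = r i := by
  classical
  let X := Σ j, D.NodeState j
  let ev : (X → ℝ) → (X → ℝ) →ₗ[ℝ] ℝ := fun b => ∑ x, b x • LinearMap.proj x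
  have hev : ∀ b w, ev b w = ∑ x, b x * w x := by
    intro b w
    simp [ev, LinearMap.sum_apply]
  let κ : X → ℝ := fun x => ∑ i, r i * D.realExponent x.1 x.2 (.inr (.inl i))
  have hspan : ev κ ∈ Submodule.span ℝ
      (Set.range fun c => ev fun x => (D.constraintMatrix c x : ℝ)) := by
    refine mem_span_of_iInf_ker_le_ker fun w hw => ?_
    simp only [Submodule.mem_iInf, LinearMap.mem_ker, hev] at hw ⊢
    have h1 := h (fun j s => w ⟨j, s⟩)
      (fun j => by rw [← hw (.inl j), sum_constraintMatrix_inl])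
      (by rw [← hw (.inr (.inl ())), sum_constraintMatrix_t]; rfl)
      (fun i => by
        have h2 := hw (.inr (.inr i))
        rw [sum_constraintMatrix_su, sub_eq_zero] at h2
        exact h2)
    rw [← h1]
    have h2 : ∀ i, moment D.realExponent (fun j s => w ⟨j, s⟩) (.inr (.inl i)) =
        ∑ x : X, w x * D.realExponent x.1 x.2 (.inr (.inl i)) := fun i => by
      rw [moment, Fintype.sum_sigma]
    simp only [κ, h2, Finset.mul_sum, Finset.sum_mul]
    rw [Finset.sum_comm]
    exact Finset.sum_congr rfl fun i _ => Finset.sum_congr rfl fun x _ => by ring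
  obtain ⟨c, hc⟩ := (Submodule.mem_span_range_iff_exists_fun ℝ).1 hspan
  have hx : ∀ x : X, κ x = ∑ k, c k * (D.constraintMatrix k x : ℝ) := by
    intro x
    have hs : ∀ b, ev b (Pi.single x 1) = b x := by
      intro b
      rw [hev, Finset.sum_eq_single x]
      · simp
      · intro x' _ hne
        simp [hne]
      · simp
    have h1 := congrArg (fun f => f (Pi.single x 1)) hc
    simp only [LinearMap.sum_apply, LinearMap.smul_apply, hs, smul_eq_mul] at h1
    exact h1.symm
  have hx' : ∀ x : X, ∑ i, r i * D.realExponent x.1 x.2 (.inr (.inl i)) =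
      c (.inl x.1) + c (.inr (.inl ())) * D.realExponent x.1 x.2 (.inl ()) +
        ∑ i, c (.inr (.inr i)) * (D.realExponent x.1 x.2 (.inr (.inl i)) -
          D.realExponent x.1 x.2 (.inr (.inr i))) := by
    intro x
    have h1 := hx x
    have h2 : ∑ j, c (.inl j) * (D.constraintMatrix (.inl j) x : ℝ) = c (.inl x.1) := by
      rw [Finset.sum_eq_single x.1]
      · simp [constraintMatrix]
      · intro j _ hj
        simp [constraintMatrix, hj.symm]
      · simp
    rw [Fintype.sum_sum_type, h2, Fintype.sum_sum_type, ← add_assoc] at h1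
    refine h1.trans ?_
    refine congrArg₂ _ (congrArg₂ _ rfl ?_)
      (Finset.sum_congr rfl fun i _ => by simp [constraintMatrix, realExponent])
    simp [constraintMatrix, realExponent]
  have hc0 : ∀ j, c (.inl j) = 0 := by
    intro j
    obtain ⟨s, hs⟩ := exists_exponent_eq_zero j
    have h1 := hx' ⟨j, s⟩
    simpa [realExponent, hs] using h1.symm
  refine ⟨Sum.elim (fun _ => -c (.inr (.inl ())))
    (Sum.elim (fun i => r i - c (.inr (.inr i))) fun i => c (.inr (.inr i))), fun j s => ?_,
    fun i => by simp⟩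
  have h1 := hx' ⟨j, s⟩
  rw [hc0, zero_add] at h1
  rw [energy, Fintype.sum_sum_type, Fintype.sum_sum_type]
  simp only [Sum.elim_inl, Sum.elim_inr, Finset.univ_unique, Finset.sum_singleton, mul_sub,
    Finset.sum_sub_distrib] at h1 ⊢
  simp only [mul_comm (r _), mul_comm (c _)] at h1
  rw [h1]
  change D.realExponent j s (.inl ()) * _ + _ = 0
  ring

end DegreePair

/-! ### The saddle point equations -/

/-- Fermat's theorem in logarithmic coordinates. -/
theorem eq_mul_deriv_div_of_forall_le {F : ℝ → ℝ} {x c : ℝ} (hx : 0 < x) (hF : 0 < F x)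
    (hd : DifferentiableAt ℝ F x)
    (h : ∀ z, 0 < z → log (F x) - c * log x ≤ log (F z) - c * log z) :
    c = x * deriv F x / F x := by
  have hmin : IsLocalMin (fun z => log (F z) - c * log z) x := by
    filter_upwards [lt_mem_nhds hx] with z hz using h z hz
  have h0 := hmin.hasDerivAt_eq_zero
    ((hd.hasDerivAt.log hF.ne').sub ((hasDerivAt_log hx.ne').const_mul c))
  field_simp at h0 ⊢
  linarith

namespace DegreePair

variable {m : ℕ} (D : DegreePair m)

theorem sum_mul_log_update (β u : Fin m → ℝ) (i : Fin m) (z : ℝ) :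
    ∑ k, β k * log (Function.update u i z k) =
      ∑ k, β k * log (u k) + β i * (log z - log (u i)) := by
  rw [← sub_eq_iff_eq_add', ← Finset.sum_sub_distrib, Finset.sum_eq_single i]
  · simp; ring
  · intro k _ hk
    simp [hk]
  · simp

theorem update_pos {u : Fin m → ℝ} (hu : ∀ i, 0 < u i) (i : Fin m) {z : ℝ} (hz : 0 < z)
    (k : Fin m) : 0 < Function.update u i z k := by
  rcases eq_or_ne k i with rfl | hk
  · simpa using hz
  · simpa [hk] using hu k

theorem differentiableAt_update (u : Fin m → ℝ) (i k : Fin m) (z : ℝ) :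
    DifferentiableAt ℝ (fun x => Function.update u i x k) z := by
  rcases eq_or_ne k i with rfl | hk
  · simp
  · simp [hk]

theorem checkPolynomial_pos (d : {d // d ∈ D.mu.support}) {u : Fin m → ℝ} (hu : ∀ i, 0 < u i) :
    0 < ((∏ i, (1 + u i) ^ d.1 i) + ∏ i, (1 - u i) ^ d.1 i) / 2 := by
  have h := D.partitionFn_inr d (logCoord 1 u u)
  simp only [logCoord, Sum.elim_inr, exp_log (hu _)] at h
  rw [← h]
  exact partitionFn_pos (T := D.NodeState (.inr d)) _ _

theorem Q_pos {t : ℝ} {s : Fin m → ℝ} (ht : 0 < t) (hs : ∀ i, 0 < s i) : 0 < D.Q t s :=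
  Finset.prod_pos fun _ _ => rpow_pos_of_pos
    (add_pos one_pos (mul_pos (pow_pos ht _) (Finset.prod_pos fun i _ => pow_pos (hs i) _))) _

theorem P_pos {u : Fin m → ℝ} (hu : ∀ i, 0 < u i) : 0 < D.P u :=
  Finset.prod_pos fun d hd => rpow_pos_of_pos (D.checkPolynomial_pos ⟨d, hd⟩ hu) _

theorem differentiableAt_Q {f : ℝ → ℝ} {g : ℝ → Fin m → ℝ} {x : ℝ}
    (hf : DifferentiableAt ℝ f x) (hg : ∀ i, DifferentiableAt ℝ (fun z => g z i) x)
    (ht : 0 < f x) (hs : ∀ i, 0 < g x i) : DifferentiableAt ℝ (fun z => D.Q (f z) (g z)) x := by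
  unfold Q
  refine DifferentiableAt.fun_finsetProd fun _ _ => ?_
  refine DifferentiableAt.rpow_const ?_ (Or.inl ?_)
  · exact (differentiableAt_const _).add ((hf.pow _).mul
      (DifferentiableAt.fun_finsetProd fun i _ => (hg i).pow _))
  · exact (add_pos one_pos (mul_pos (pow_pos ht _)
      (Finset.prod_pos fun i _ => pow_pos (hs i) _))).ne'

theorem differentiableAt_P {g : ℝ → Fin m → ℝ} {x : ℝ}
    (hg : ∀ i, DifferentiableAt ℝ (fun z => g z i) x) (hu : ∀ i, 0 < g x i) :
    DifferentiableAt ℝ (fun z => D.P (g z)) x := by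
  unfold P
  refine DifferentiableAt.fun_finsetProd fun d hd => ?_
  refine DifferentiableAt.rpow_const ?_ (Or.inl (D.checkPolynomial_pos ⟨d, hd⟩ hu).ne')
  exact ((DifferentiableAt.fun_finsetProd fun i _ =>
      ((differentiableAt_const _).add (hg i)).pow _).add
    (DifferentiableAt.fun_finsetProd fun i _ =>
      ((differentiableAt_const _).sub (hg i)).pow _)).div_const 2

variable {D}

/-- The saddle point equations at a point where the infimum `γ(β)` is attained. -/
theorem saddle_point_equations {ω : ℝ} {β : Fin m → ℝ} {t : ℝ} {s u : Fin m → ℝ} (ht : 0 < t)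
    (hs : ∀ i, 0 < s i) (hu : ∀ i, 0 < u i)
    (h : ∀ t' s' u', 0 < t' → (∀ i, 0 < s' i) → (∀ i, 0 < u' i) →
      D.objective ω β t s u ≤ D.objective ω β t' s' u') :
    ω = t * deriv (fun y => D.Q y s) t / D.Q t s ∧
    (∀ i, β i = u i * deriv (fun y => D.P (Function.update u i y)) (u i) / D.P u) ∧
    (∀ i, β i = s i * deriv (fun y => D.Q t (Function.update s i y)) (s i) / D.Q t s) := by
  refine ⟨?_, fun i => ?_, fun i => ?_⟩
  · refine eq_mul_deriv_div_of_forall_le (F := fun y => D.Q y s) ht (D.Q_pos ht hs)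
      (D.differentiableAt_Q differentiableAt_id (fun i => differentiableAt_const _) ht hs) ?_
    intro z hz
    have h1 := h z s u hz hs hu
    simp only [objective] at h1
    linarith
  · have h0 : D.P u = D.P (Function.update u i (u i)) := by rw [Function.update_eq_self]
    conv_rhs => rw [h0]
    refine eq_mul_deriv_div_of_forall_le (F := fun y => D.P (Function.update u i y)) (hu i)
      (D.P_pos (update_pos hu i (hu i)))
      (D.differentiableAt_P (fun k => differentiableAt_update u i k _) (update_pos hu i (hu i))) ?_
    intro z hz
    have h1 := h t s (Function.update u i z) ht hs (update_pos hu i hz)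
    simp only [objective, sum_mul_log_update] at h1
    simp only [← h0]
    linarith
  · have h0 : D.Q t s = D.Q t (Function.update s i (s i)) := by rw [Function.update_eq_self]
    conv_rhs => rw [h0]
    refine eq_mul_deriv_div_of_forall_le (F := fun y => D.Q t (Function.update s i y)) (hs i)
      (D.Q_pos ht (update_pos hs i (hs i)))
      (D.differentiableAt_Q (differentiableAt_const _) (fun k => differentiableAt_update s i k _)
        ht (update_pos hs i (hs i))) ?_
    intro z hz
    have h1 := h t (Function.update s i z) u ht (update_pos hs i hz) hu
    simp only [objective, sum_mul_log_update] at h1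
    simp only [← h0]
    linarith

theorem pos_of_mem_stationarySet {ω : ℝ} {β : Fin m → ℝ} (hβ : β ∈ D.stationarySet ω)
    (i : Fin m) : 0 < β i := by
  obtain ⟨t, s, u, -, hs, hu, -, -, -, h⟩ := hβ
  have hμ := D.muDeriv_pos i
  have h1 : 0 < β i / (D.muDeriv i - β i) := by rw [h i]; exact mul_pos (hu i) (hs i)
  rcases div_pos_iff.1 h1 with ⟨h2, -⟩ | ⟨h2, h3⟩
  · exact h2
  · linarith

/-- If the extrema are attained, at `β` and some `(t, s, u)`, then `β` itself is stationary, with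
possibly different `(t, s, u)`. -/
theorem ExtremaAttained.exists_mem_stationarySet {ω : ℝ} (h : D.ExtremaAttained ω) :
    ∃ β ∈ D.stationarySet ω, D.gammaBeta ω β = D.supGamma ω := by
  obtain ⟨β, t, s, u, -, ht, hs, hu, hsup, hinf⟩ := h
  set y := logCoord t s u with hy
  have hobj := D.objective_eq ω β ht hs hu
  rw [← hy] at hobj
  rw [hobj] at hinf
  have hmin := D.le_gammaBeta_iff.1 hinf.ge
  have hm := moment_gibbs_eq D.realExponent (ρ := D.density) (c := target ω β) (y := y)
    (fun z => by linarith [hmin z])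
  obtain ⟨v, hv, hvr⟩ := exists_flat_direction
    (fun i => log (β i / (D.muDeriv i - β i)) - y (.inr (.inl i)) - y (.inr (.inr i)))
    (first_variation_eq_zero (hsup.trans hinf) hm)
  have hlp : logPartition D.realExponent D.density (y + v) =
      logPartition D.realExponent D.density y := by
    have h1 : ∀ j s, energy (D.realExponent j s) (y + v) = energy (D.realExponent j s) y := by
      intro j s
      have h2 := energy_add_smul (D.realExponent j s) y v 1
      rwa [one_smul, hv, mul_zero, add_zero] at h2
    simp only [logPartition, partitionFn, h1]
  have hlin : ∑ q, target ω β q * (y + v) q = ∑ q, target ω β q * y q := by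
    have h1 := moment_mul_eq D.realExponent (gibbs D.realExponent D.density y) v
    simp only [hv, mul_zero, Finset.sum_const_zero, hm] at h1
    simp only [Pi.add_apply, mul_add, Finset.sum_add_distrib, h1, add_zero]
  set t' := exp ((y + v) (.inl ())) with ht'
  set s' : Fin m → ℝ := fun i => exp ((y + v) (.inr (.inl i))) with hs'
  set u' : Fin m → ℝ := fun i => exp ((y + v) (.inr (.inr i))) with hu'
  have hobj' : D.objective ω β t' s' u' = D.objective ω β t s u := by
    rw [ht', hs', hu', objective_exp, hlp, hlin, hobj]
  obtain ⟨h1, h2, h3⟩ := saddle_point_equations (D := D) (ω := ω) (β := β) (exp_pos _ : 0 < t')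
    (fun i => (exp_pos _ : 0 < s' i)) (fun i => (exp_pos _ : 0 < u' i)) (by
      intro t₁ s₁ u₁ ht₁ hs₁ hu₁
      rw [hobj', hobj, D.objective_eq ω β ht₁ hs₁ hu₁]
      exact hmin _)
  refine ⟨β, ⟨t', s', u', exp_pos _, fun i => exp_pos _, fun i => exp_pos _, h1, h2, h3,
    fun i => ?_⟩, hsup.symm⟩
  have hβ := moment_gibbs_s_mem (D := D) y i
  rw [hm] at hβ
  have hβ' : 0 < β i ∧ β i < D.muDeriv i := hβ
  have hq : 0 < β i / (D.muDeriv i - β i) := div_pos hβ'.1 (sub_pos.2 hβ'.2)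
  rw [hu', hs', ← exp_add]
  have e : (y + v) (.inr (.inr i)) + (y + v) (.inr (.inl i)) =
      log (β i / (D.muDeriv i - β i)) := by
    have := hvr i
    simp only [Pi.add_apply]
    linarith
  simp only [e, exp_log hq]

end DegreePair

end MET

theorem theorem2 {m : ℕ} (D : MET.DegreePair m) (ω : ℝ) :
    Tendsto (fun n : ℕ => ((1 / (n : ℝ) * Real.log (D.avgCodewords n ⌊ω * n⌋₊) : ℝ) : EReal))
        (D.lengths ω) (𝓝 (D.supGamma ω)) ∧
      (D.ExtremaAttained ω →
        IsGreatest (D.gammaBeta ω '' D.stationarySet ω) (D.supGamma ω)) := by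
  refine ⟨MET.DegreePair.tendsto_rate D ω, fun h => ⟨?_, ?_⟩⟩
  · obtain ⟨β, hβ, hγ⟩ := h.exists_mem_stationarySet
    exact ⟨β, hβ, hγ⟩
  · rintro _ ⟨β, hβ, rfl⟩
    exact le_iSup₂_of_le (f := fun (β : Fin m → ℝ) (_ : ∀ i, 0 ≤ β i) => D.gammaBeta ω β) β
      (fun i => (MET.DegreePair.pos_of_mem_stationarySet hβ i).le) le_rfl
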